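/- Let $f\in\mathbb Z[x]$ be irreducible over $\mathbb Q$ of degree $d\ge 2$. For $N\ge 1$ let $\alpha_p(N)$ denote the exponent of the prime $p$ in $Q(N)=\prod_{n=1}^N|f(n)|$, let $Q_S(N)=\prod_{p\le N}p^{\alpha_p(N)}$ (product over primes $p\le N$), and let $L_f(N)=\operatorname{lcm}\{f(n):1\le n\le N\}$. Then $$\lim_{N\to\infty}\frac{\log Q_S(N)}{N\log N}=1 .$$ Consequently, for every $\varepsilon>0$ we have $\log L_f(N)\le(1+\varepsilon)(d-1)N\log N$ for all sufficiently large $N$. -/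

import Mathlib

open Filter Topology

namespace PolyLcm

/-- The product `Q(N) = ∏_{n = 1}^N |f(n)|`, a natural number. -/
def Q (f : Polynomial ℤ) (N : ℕ) : ℕ :=
  ∏ n ∈ (Finset.Icc 1 N : Finset ℕ), (f.eval (n : ℤ)).natAbs

/-- `α_p(N)`, the exponent of the prime `p` in `Q(N)`. -/
def alpha (f : Polynomial ℤ) (p N : ℕ) : ℕ :=
  (Q f N).factorization p

/-- `Q_S(N) = ∏_{p ≤ N} p ^ α_p(N)`, the part of `Q(N)` made of the primes `p ≤ N`. -/
def QS (f : Polynomial ℤ) (N : ℕ) : ℕ :=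
  ∏ p ∈ (Finset.Icc 1 N : Finset ℕ) with p.Prime, p ^ alpha f p N

/-- `L_f(N) = lcm {f(n) : 1 ≤ n ≤ N}`, where values `0` are ignored and the lcm of the empty
set is `1`. -/
def L (f : Polynomial ℤ) (N : ℕ) : ℕ :=
  ((Finset.Icc 1 N).filter (fun n : ℕ => f.eval (n : ℤ) ≠ 0)).lcm
    (fun n : ℕ => (f.eval (n : ℤ)).natAbs)

end PolyLcm

/-! Write ρ(p) for `rootCount f p`. Since log Q_S(N) is the sum of α_p(N) log p over p ≤ N, the
exponents must be known on average. Irreducibility gives u f + v f' = D with D a nonzero integer.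
For p not dividing D, uniqueness in Hensel's lemma leaves at most ρ(p) roots modulo each p^k, so
α_p(N) is ρ(p) N/p up to O(N/p²) and one unit per root and per admissible k
(`divCount_le_rootCount_mul`, `alpha_mul_log_le`). Summed against log p, the errors are O(N) because
ρ(p) is bounded and π(N) = O(N / log N); each of the finitely many p dividing D contributes only
O(N).

What remains is ∑ ρ(p) log p / p ~ log N (`tendsto_sum_rootCount_mul_log_div`). Outside finitely
many p, ρ(p) is the number of ideals of norm p in the ring of integers of K = ℚ[x]/(f)
(`exists_natCard_absNorm_eq_rootCount`). The Mertens estimate for these ideals follows Chebyshev's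
method: the number A(N) of nonzero ideals of norm at most N is asymptotic to cN, and ∑ log N(I) over
them is evaluated twice, as ~ c N log N by counting and through prime factorisation as a sum of log
N(P) · A(N / N(P)) up to O(N). Comparison (`tendsto_sum_div_log`) removes c. No prime ideal theorem
is needed.

For the lcm, let M = C N^d bound the values, and let P be the product of the largest powers at most
M of the primes p ≤ N. Then L · Q_S divides Q · P (`log_L_add_log_QS_le`). Here log Q ≤ N log M ~ d
N log N, while log P ≤ π(N) log M is negligible; subtracting log Q_S ~ N log N leaves d - 1. -/

namespace PolyLcm

/-! ### Roots modulo p and ideals of norm p -/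

open Polynomial

/-- The number of residues `n` modulo `p` with `p ∣ f(n)`. -/
def rootCount (f : ℤ[X]) (p : ℕ) : ℕ :=
  ((Finset.range p).filter (fun n : ℕ => (p : ℤ) ∣ f.eval (n : ℤ))).card

theorem eval₂_natCast_zmod (f : ℤ[X]) (p n : ℕ) :
    f.eval₂ (Int.castRingHom (ZMod p)) (n : ZMod p) = ((f.eval (n : ℤ) : ℤ) : ZMod p) := by
  simp

theorem rootCount_eq_natCard (f : ℤ[X]) (p : ℕ) [Fact p.Prime] :
    rootCount f p = Nat.card {r : ZMod p // f.eval₂ (Int.castRingHom (ZMod p)) r = 0} := by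
  classical
  rw [Nat.card_eq_fintype_card, Fintype.card_subtype, rootCount]
  refine Finset.card_bij (fun n _ => (n : ZMod p)) ?_ ?_ ?_
  · intro n hn
    simp only [Finset.mem_filter, Finset.mem_range, Finset.mem_univ, true_and] at hn ⊢
    rw [eval₂_natCast_zmod, ZMod.intCast_zmod_eq_zero_iff_dvd]
    exact hn.2
  · intro a ha b hb hab
    simp only [Finset.mem_filter, Finset.mem_range] at ha hb
    rw [ZMod.natCast_eq_natCast_iff'] at hab
    rwa [Nat.mod_eq_of_lt ha.1, Nat.mod_eq_of_lt hb.1] at hab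
  · intro r hr
    refine ⟨r.val, ?_, by simp⟩
    simp only [Finset.mem_filter, Finset.mem_range, Finset.mem_univ, true_and] at hr ⊢
    refine ⟨ZMod.val_lt r, ?_⟩
    rw [← ZMod.intCast_zmod_eq_zero_iff_dvd, ← eval₂_natCast_zmod]
    simpa using hr

/-- Modulo the kernel every element is congruent to a natural number, whose image is forced. -/
theorem ringHom_zmod_eq_of_ker_eq {R : Type*} [CommRing R] {p : ℕ} [Fact p.Prime]
    {φ ψ : R →+* ZMod p} (h : RingHom.ker φ = RingHom.ker ψ) : φ = ψ := by
  ext x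
  have h1 : x - ((φ x).val : R) ∈ RingHom.ker φ := by
    rw [RingHom.mem_ker]; simp
  rw [h, RingHom.mem_ker, map_sub, map_natCast, ZMod.natCast_zmod_val] at h1
  exact (sub_eq_zero.mp h1).symm

/-- Ideals of prime norm `p` are the kernels of the homomorphisms to `ZMod p`. -/
theorem natCard_absNorm_eq_prime (R : Type*) [CommRing R] [IsDedekindDomain R]
    [Module.Free ℤ R] (p : ℕ) [hp : Fact p.Prime] :
    Nat.card {P : Ideal R // Ideal.absNorm P = p} = Nat.card (R →+* ZMod p) := by
  have hker : ∀ φ : R →+* ZMod p, Ideal.absNorm (RingHom.ker φ) = p := by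
    intro φ
    have e := RingHom.quotientKerEquivOfSurjective (ZMod.ringHom_surjective φ)
    rw [Ideal.absNorm_apply, Submodule.cardQuot_apply]
    exact (Nat.card_congr e.toEquiv).trans (Nat.card_zmod p)
  refine (Nat.card_congr (Equiv.ofBijective (fun φ => ⟨RingHom.ker φ, hker φ⟩) ⟨?_, ?_⟩)).symm
  · intro φ ψ h
    exact ringHom_zmod_eq_of_ker_eq (by simpa using h)
  · rintro ⟨P, hP⟩
    rw [Ideal.absNorm_apply, Submodule.cardQuot_apply] at hP
    have : Finite (R ⧸ P) := Nat.finite_of_card_ne_zero (by rw [hP]; exact hp.out.ne_zero)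
    have := Fintype.ofFinite (R ⧸ P)
    rw [Nat.card_eq_fintype_card] at hP
    let e := ZMod.ringEquivOfPrime (R ⧸ P) hp.out hP
    refine ⟨(e.symm : (R ⧸ P) →+* ZMod p).comp (Ideal.Quotient.mk P), ?_⟩
    ext x
    simp [RingHom.mem_ker, Ideal.Quotient.eq_zero_iff_mem]

/-- If `m R ⊆ ℤ[β]` and `p ∤ m`, homomorphisms `R → ZMod p` are given by the roots modulo `p` of
the polynomial generating the relations of `β`. -/
theorem natCard_ringHom_zmod {R : Type*} [CommRing R] (β : R) (g : ℤ[X]) (hg : aeval β g = 0)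
    (hrel : ∀ q : ℤ[X], aeval β q = 0 → g ∣ q) (m : ℤ)
    (hm : ∀ x : R, ∃ q : ℤ[X], (m : R) * x = aeval β q)
    (p : ℕ) [hp : Fact p.Prime] (hpm : ¬ (p : ℤ) ∣ m) :
    Nat.card (R →+* ZMod p) =
      Nat.card {r : ZMod p // g.eval₂ (Int.castRingHom (ZMod p)) r = 0} := by
  have hm0 : (m : ZMod p) ≠ 0 := by
    rwa [Ne, ZMod.intCast_zmod_eq_zero_iff_dvd]
  have key : ∀ (φ : R →+* ZMod p) (q : ℤ[X]),
      φ (aeval β q) = q.eval₂ (Int.castRingHom (ZMod p)) (φ β) := by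
    intro φ q
    rw [aeval_def, hom_eval₂]
    congr 1
    exact RingHom.ext_int _ _
  refine Nat.card_congr (Equiv.ofBijective (fun φ => ⟨φ β, ?_⟩) ⟨?_, ?_⟩)
  · rw [← key, hg, map_zero]
  · intro φ ψ h
    have h' : φ β = ψ β := by simpa using h
    ext x
    obtain ⟨q, hq⟩ := hm x
    have h1 : φ ((m : R) * x) = ψ ((m : R) * x) := by rw [hq, key, key, h']
    rw [map_mul, map_mul, map_intCast, map_intCast] at h1
    exact mul_left_cancel₀ hm0 h1
  · rintro ⟨r, hr⟩
    choose q hq using hm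
    set ev := eval₂RingHom (Int.castRingHom (ZMod p)) r with hev
    have hwd : ∀ q₁ q₂ : ℤ[X], aeval β q₁ = aeval β q₂ → ev q₁ = ev q₂ := by
      intro q₁ q₂ h
      obtain ⟨s, hs⟩ := hrel (q₁ - q₂) (by rw [map_sub, h, sub_self])
      rw [← sub_eq_zero, ← map_sub, hs, map_mul]
      have : ev g = 0 := hr
      rw [this, zero_mul]
    have hC : ∀ n : ℤ, ev (C n) = (n : ZMod p) := by
      intro n; simp [hev]
    -- Evaluation at r descends from ℤ[β] because all relations of β are multiples of g; it extends
    -- to R by dividing by m, a unit modulo p. Each ring axiom is a comparison of two polynomials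
    -- with the same value at β.
    let φ : R →+* ZMod p :=
      { toFun := fun x => (m : ZMod p)⁻¹ * ev (q x)
        map_one' := by
          have : ev (q 1) = ev (C m) := hwd _ _ (by rw [← hq]; simp)
          rw [this, hC, inv_mul_cancel₀ hm0]
        map_zero' := by
          have : ev (q 0) = ev 0 := hwd _ _ (by rw [← hq]; simp)
          rw [this, map_zero, mul_zero]
        map_add' := by
          intro x y
          have : ev (q (x + y)) = ev (q x + q y) :=
            hwd _ _ (by rw [← hq, map_add, ← hq, ← hq]; ring)
          rw [this, map_add]; ring
        map_mul' := by
          intro x y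
          have : ev (C m * q (x * y)) = ev (q x * q y) :=
            hwd _ _ (by rw [map_mul, map_mul, ← hq, ← hq, ← hq]; simp; ring)
          rw [map_mul, map_mul, hC] at this
          field_simp
          linear_combination this }
    refine ⟨φ, Subtype.ext ?_⟩
    change (m : ZMod p)⁻¹ * ev (q β) = r
    have : ev (q β) = ev (C m * X) := hwd _ _ (by rw [← hq]; simp)
    rw [this, map_mul, hC, inv_mul_cancel_left₀ hm0]
    simp [hev]

/-- Multiplication by the leading coefficient, a unit modulo p, matches the two sets of roots. -/
theorem natCard_roots_integralNormalization (f : ℤ[X]) (hf : 1 ≤ f.natDegree) (p : ℕ)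
    [hp : Fact p.Prime] (hpa : ¬ (p : ℤ) ∣ f.leadingCoeff) :
    Nat.card {r : ZMod p // f.integralNormalization.eval₂ (Int.castRingHom (ZMod p)) r = 0} =
      Nat.card {r : ZMod p // f.eval₂ (Int.castRingHom (ZMod p)) r = 0} := by
  have ha : (f.leadingCoeff : ZMod p) ≠ 0 := by
    rwa [Ne, ZMod.intCast_zmod_eq_zero_iff_dvd]
  refine (Nat.card_congr ((Equiv.mulLeft₀ _ ha).subtypeEquiv fun r => ?_)).symm
  have := integralNormalization_eval₂_leadingCoeff_mul hf (Int.castRingHom (ZMod p)) r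
  simp only [eq_intCast] at this
  rw [Equiv.mulLeft₀_apply, this]
  simp [ha]

-- Since f need not be monic, α is replaced by the integral element β = aα, with a the leading
-- coefficient. Ideals of norm p correspond to maps 𝓞 K → `ZMod p`, these to roots of the minimal
-- polynomial of β, and these to roots of f. The excluded primes divide m · a, where m is the
-- discriminant of the power basis of β, so that m 𝓞 K ⊆ ℤ[β].
open NumberField in
theorem exists_natCard_absNorm_eq_rootCount {K : Type*} [Field K] [NumberField K] (f : ℤ[X])
    (hirr : Irreducible (f.map (Int.castRingHom ℚ))) (hdeg : 1 ≤ f.natDegree) (α : K)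
    (hfα : aeval α f = 0) (hαtop : Algebra.adjoin ℚ {α} = ⊤) :
    ∃ D : ℕ, D ≠ 0 ∧ ∀ p : ℕ, p.Prime → ¬ p ∣ D →
      Nat.card {P : Ideal (𝓞 K) // Ideal.absNorm P = p} = rootCount f p := by
  set F := f.map (Int.castRingHom ℚ) with hF
  have hf0 : f ≠ 0 := by rintro rfl; simp at hdeg
  have ha0 : f.leadingCoeff ≠ 0 := by simpa using hf0
  set a : ℤ := f.leadingCoeff with ha
  set g := f.integralNormalization with hg
  have hmap : (algebraMap ℤ K) = (algebraMap ℚ K).comp (Int.castRingHom ℚ) := RingHom.ext_int _ _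
  have hFα : aeval α F = 0 := by
    rw [aeval_def, hF, eval₂_map, ← hmap]; exact hfα
  set β : K := algebraMap ℤ K a * α with hβ
  have hgβ : aeval β g = 0 := by
    refine integralNormalization_aeval_eq_zero hfα ?_
    intro x hx
    simpa using hx
  have hgm : g.Monic := monic_integralNormalization hf0
  have hβi : IsIntegral ℤ β := ⟨g, hgm, hgβ⟩
  have hβq : IsIntegral ℚ β := hβi.tower_top
  have haK : algebraMap ℤ K a = algebraMap ℚ K a := by simp
  have hadj : Algebra.adjoin ℚ {β} = ⊤ := by
    rw [eq_top_iff, ← hαtop, Algebra.adjoin_le_iff, Set.singleton_subset_iff]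
    have h1 : α = (a : ℚ)⁻¹ • β := by
      rw [hβ, haK, ← Algebra.smul_def, smul_smul, inv_mul_cancel₀ (by exact_mod_cast ha0), one_smul]
    rw [h1]
    exact Subalgebra.smul_mem _ (Algebra.self_mem_adjoin_singleton ℚ β) _
  set B := PowerBasis.ofAdjoinEqTop hβq hadj with hB
  have hBgen : B.gen = β := PowerBasis.ofAdjoinEqTop_gen _ _
  have hdisc0 := Algebra.discr_not_zero_of_basis ℚ B.basis
  obtain ⟨m, hmd⟩ : ∃ m : ℤ, (m : ℚ) = Algebra.discr ℚ B.basis := by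
    have : IsIntegral ℤ (Algebra.discr ℚ B.basis) := Algebra.discr_isIntegral ℚ fun i => by
      rw [B.coe_basis, hBgen]; exact hβi.pow _
    simpa using IsIntegrallyClosed.isIntegral_iff.mp this
  have hm0 : m ≠ 0 := by
    rintro rfl; rw [← hmd] at hdisc0; simp at hdisc0
  let b : 𝓞 K := ⟨β, hβi⟩
  have hb : algebraMap (𝓞 K) K b = β := rfl
  have haev : ∀ q : ℤ[X], algebraMap (𝓞 K) K (aeval b q) = aeval β q := by
    intro q; rw [← hb, aeval_algebraMap_apply]
  have hinj : Function.Injective (algebraMap (𝓞 K) K) := FaithfulSMul.algebraMap_injective _ _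
  have hdegF : F.natDegree = f.natDegree := natDegree_map_eq_of_injective Int.cast_injective _
  -- Both are monic, the minimal polynomial divides g, and both have degree [K : ℚ] because β
  -- generates K.
  have hgmin : g = minpoly ℤ β := by
    refine eq_of_monic_of_dvd_of_natDegree_le (minpoly.monic hβi) hgm
      (minpoly.isIntegrallyClosed_dvd hβi hgβ) ?_
    have h1 : (minpoly ℚ β).natDegree = (minpoly ℤ β).natDegree := by
      rw [minpoly.isIntegrallyClosed_eq_field_fractions' ℚ hβi,
        natDegree_map_eq_of_injective Int.cast_injective]
    have h2 := B.natDegree_minpoly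
    have h3 := (PowerBasis.ofAdjoinEqTop (Algebra.IsIntegral.isIntegral (R := ℚ) α)
      hαtop).natDegree_minpoly
    rw [PowerBasis.ofAdjoinEqTop_gen, ← PowerBasis.finrank, ← minpoly.eq_of_irreducible hirr hFα,
      natDegree_mul_C (by simpa using hirr.ne_zero), hdegF] at h3
    rw [hBgen, ← B.finrank, ← h3] at h2
    rw [← h1, h2, natDegree_integralNormalization]
  refine ⟨(m * a).natAbs, by simpa using ⟨hm0, ha0⟩, fun p hp hpD => ?_⟩
  have : Fact p.Prime := ⟨hp⟩
  have hpD' : ¬ (p : ℤ) ∣ m * a := by rwa [Int.natCast_dvd]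
  rw [natCard_absNorm_eq_prime, rootCount_eq_natCard,
    natCard_ringHom_zmod b g (hinj (by rw [haev, hgβ, map_zero])) ?_ m ?_ p
      (fun h => hpD' (h.mul_right _)),
    natCard_roots_integralNormalization f hdeg p (fun h => hpD' (h.mul_left _))]
  · intro q hq
    rw [hgmin]
    refine minpoly.isIntegrallyClosed_dvd hβi ?_
    rw [← haev, hq, map_zero]
  · intro x
    have h1 := Algebra.discr_mul_isIntegral_mem_adjoin ℚ (R := ℤ) (B := B)
      (by rw [hBgen]; exact hβi) (z := (x : K)) x.isIntegral_coe
    rw [hBgen, Algebra.adjoin_singleton_eq_range_aeval] at h1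
    obtain ⟨q, hq⟩ := h1
    refine ⟨q, hinj ?_⟩
    rw [haev]
    refine Eq.trans ?_ hq.symm
    rw [← hmd, Algebra.smul_def]
    simp

end PolyLcm

/-! ### An abstract Mertens theorem -/

namespace PolyLcm

/-- The constant B absorbs the bounded range of x where the limit says nothing. The bound is then
uniform and can be used at x = N / n even when n is close to N. -/
theorem abs_sub_mul_le_of_tendsto_div {A : ℕ → ℝ} {c : ℝ}
    (hA : Tendsto (fun x : ℝ => A ⌊x⌋₊ / x) atTop (𝓝 c)) {ε : ℝ} (hε : 0 < ε) :
    ∃ B : ℝ, 0 ≤ B ∧ ∀ x : ℝ, 0 ≤ x → |A ⌊x⌋₊ - c * x| ≤ ε * x + B := by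
  obtain ⟨x₀, hx₀⟩ := eventually_atTop.mp (Metric.tendsto_nhds.mp hA ε hε)
  refine ⟨∑ k ∈ Finset.range (⌊max x₀ 1⌋₊ + 1), |A k| + |c| * max x₀ 1, by positivity,
    fun x hx => ?_⟩
  rcases le_or_gt (max x₀ 1) x with h | h
  · have hx1 : 0 < x := by linarith [le_max_right x₀ 1]
    have h1 := hx₀ x ((le_max_left _ _).trans h)
    rw [Real.dist_eq] at h1
    have h2 : A ⌊x⌋₊ - c * x = (A ⌊x⌋₊ / x - c) * x := by field_simp
    rw [h2, abs_mul, abs_of_pos hx1]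
    have : 0 ≤ ∑ k ∈ Finset.range (⌊max x₀ 1⌋₊ + 1), |A k| + |c| * max x₀ 1 := by positivity
    nlinarith
  · have h1 : |A ⌊x⌋₊| ≤ ∑ k ∈ Finset.range (⌊max x₀ 1⌋₊ + 1), |A k| :=
      Finset.single_le_sum (f := fun k => |A k|) (fun _ _ => abs_nonneg _)
        (Finset.mem_range.mpr (Nat.lt_succ_of_le (Nat.floor_le_floor h.le)))
    have h2 : |c * x| ≤ |c| * max x₀ 1 := by
      rw [abs_mul, abs_of_nonneg hx]; gcongr
    have h3 := abs_sub (A ⌊x⌋₊) (c * x)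
    nlinarith [mul_nonneg hε.le hx]

/-- A Mertens-type theorem: if `A(x) ∼ c x` and `∑ w(n) A(N / n) ∼ c N log N` with Chebyshev's
bound `∑ w(n) ≪ N`, then `∑ w(n) / n ∼ log N`. -/
theorem tendsto_sum_div_log {w A : ℕ → ℝ} (hw : ∀ n, 0 ≤ w n) {c C : ℝ} (hc : 0 < c)
    (hA : Tendsto (fun x : ℝ => A ⌊x⌋₊ / x) atTop (𝓝 c))
    (hsum : ∀ N : ℕ, ∑ n ∈ Finset.Icc 1 N, w n ≤ C * N)
    (hS : Tendsto (fun N : ℕ => (∑ n ∈ Finset.Icc 1 N, w n * A (N / n)) / (N * Real.log N))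
      atTop (𝓝 c)) :
    Tendsto (fun N : ℕ => (∑ n ∈ Finset.Icc 1 N, w n / n) / Real.log N) atTop (𝓝 1) := by
  set s : ℕ → ℝ := fun N => (∑ n ∈ Finset.Icc 1 N, w n * A (N / n)) / (N * Real.log N) with hs
  set m : ℕ → ℝ := fun N => (∑ n ∈ Finset.Icc 1 N, w n / n) / Real.log N with hm
  have hlog : Tendsto (fun N : ℕ => Real.log N) atTop atTop :=
    Real.tendsto_log_atTop.comp tendsto_natCast_atTop_atTop
  have key : ∀ ε : ℝ, 0 < ε → ∃ K : ℝ, ∀ᶠ N : ℕ in atTop,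
      |s N - c * m N| ≤ ε * m N + K / Real.log N := by
    intro ε hε
    obtain ⟨B, hB, hAB⟩ := abs_sub_mul_le_of_tendsto_div hA hε
    refine ⟨B * C, ?_⟩
    filter_upwards [eventually_gt_atTop 0, hlog.eventually_gt_atTop 0] with N hN hl
    have hN' : (0 : ℝ) < N := by exact_mod_cast hN
    have h1 : |∑ n ∈ Finset.Icc 1 N, w n * A (N / n) - c * (N * ∑ n ∈ Finset.Icc 1 N, w n / n)| ≤
        ε * (N * ∑ n ∈ Finset.Icc 1 N, w n / n) + B * (C * N) := by
      calc _ = |∑ n ∈ Finset.Icc 1 N, w n * (A (N / n) - c * ((N : ℝ) / n))| := by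
            congr 1
            rw [Finset.mul_sum, Finset.mul_sum, ← Finset.sum_sub_distrib]
            exact Finset.sum_congr rfl fun n _ => by ring
        _ ≤ ∑ n ∈ Finset.Icc 1 N, w n * (ε * ((N : ℝ) / n) + B) := by
            refine (Finset.abs_sum_le_sum_abs _ _).trans (Finset.sum_le_sum fun n _ => ?_)
            rw [abs_mul, abs_of_nonneg (hw n)]
            refine mul_le_mul_of_nonneg_left ?_ (hw n)
            have := hAB ((N : ℝ) / n) (by positivity)
            rwa [Nat.floor_div_eq_div] at this
        _ = ε * (N * ∑ n ∈ Finset.Icc 1 N, w n / n) + B * ∑ n ∈ Finset.Icc 1 N, w n := by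
            rw [Finset.mul_sum, Finset.mul_sum, Finset.mul_sum, ← Finset.sum_add_distrib]
            exact Finset.sum_congr rfl fun n _ => by ring
        _ ≤ _ := by gcongr; exact hsum N
    have hNl : 0 < N * Real.log N := mul_pos hN' hl
    have h2 : s N - c * m N = (∑ n ∈ Finset.Icc 1 N, w n * A (N / n) -
        c * (N * ∑ n ∈ Finset.Icc 1 N, w n / n)) / (N * Real.log N) := by
      simp only [hs, hm]; field_simp
    rw [h2, abs_div, abs_of_pos hNl, div_le_iff₀ hNl]
    refine h1.trans (le_of_eq ?_)
    simp only [hm]; field_simp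
  have hdiv : ∀ K : ℝ, Tendsto (fun N : ℕ => K / Real.log N) atTop (𝓝 0) :=
    fun K => hlog.const_div_atTop K
  -- The error in `key` involves m itself. With ε = c / 2 it is absorbed into c · m, which bounds m;
  -- only then can ε be made small.
  obtain ⟨B₀, hB₀, hbd⟩ : ∃ B₀ : ℝ, 0 < B₀ ∧ ∀ᶠ N : ℕ in atTop, m N ≤ B₀ := by
    obtain ⟨K, hK⟩ := key (c / 2) (by positivity)
    refine ⟨2 / c * (c + 1 + 1), by positivity, ?_⟩
    filter_upwards [hK, hS.eventually_le_const (lt_add_one c),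
      (hdiv K).eventually_le_const one_pos] with N h1 h2 h3
    have h4 := (abs_le.mp h1).1
    have : c / 2 * m N ≤ c + 1 + 1 := by linarith
    calc m N = 2 / c * (c / 2 * m N) := by field_simp
      _ ≤ _ := by gcongr
  have hdiff : Tendsto (fun N => s N - c * m N) atTop (𝓝 0) := by
    rw [Metric.tendsto_nhds]
    intro δ hδ
    obtain ⟨K, hK⟩ := key (δ / (2 * B₀)) (by positivity)
    filter_upwards [hK, hbd, (hdiv K).eventually_lt_const (half_pos hδ)] with N h1 h2 h3
    rw [Real.dist_eq, sub_zero]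
    calc _ ≤ _ := h1
      _ ≤ δ / (2 * B₀) * B₀ + K / Real.log N := by gcongr
      _ < δ / (2 * B₀) * B₀ + δ / 2 := by gcongr
      _ = δ := by field_simp; ring
  have h5 := ((show Tendsto s atTop (𝓝 c) from hS).sub hdiff).div_const c
  simp only [sub_sub_cancel, sub_zero, div_self hc.ne'] at h5
  refine h5.congr fun N => ?_
  field_simp

end PolyLcm

/-! ### Ideals of bounded norm and their factorisation -/

namespace PolyLcm

section NumberField

open NumberField Ideal UniqueFactorizationMonoid
open scoped Classical nonZeroDivisors

variable (K : Type*) [Field K] [NumberField K]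

/-- The nonzero ideals of norm at most `n`. -/
noncomputable def idealsLE (n : ℕ) : Finset (Ideal (𝓞 K)) :=
  (finite_setOfPred_absNorm_le (S := 𝓞 K) n).toFinset.filter (· ≠ ⊥)

/-- The nonzero prime ideals of norm at most `n`. -/
noncomputable def primeIdealsLE (n : ℕ) : Finset (Ideal (𝓞 K)) :=
  (idealsLE K n).filter Ideal.IsPrime

variable {K}

theorem mem_idealsLE {n : ℕ} {I : Ideal (𝓞 K)} : I ∈ idealsLE K n ↔ absNorm I ≤ n ∧ I ≠ ⊥ := by
  simp [idealsLE]

theorem mem_primeIdealsLE {n : ℕ} {I : Ideal (𝓞 K)} :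
    I ∈ primeIdealsLE K n ↔ absNorm I ≤ n ∧ I ≠ ⊥ ∧ I.IsPrime := by
  simp [primeIdealsLE, mem_idealsLE, and_assoc]

theorem absNorm_pos {I : Ideal (𝓞 K)} (hI : I ≠ ⊥) : 0 < absNorm I :=
  Nat.pos_of_ne_zero fun h => hI (absNorm_eq_zero_iff.mp h)

theorem two_le_absNorm {P : Ideal (𝓞 K)} (h0 : P ≠ ⊥) (hP : P.IsPrime) : 2 ≤ absNorm P := by
  have h1 := absNorm_pos h0
  have h2 : absNorm P ≠ 1 := fun h => hP.ne_top (absNorm_eq_one_iff.mp h)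
  omega

theorem exists_tendsto_card_idealsLE (K : Type*) [Field K] [NumberField K] :
    ∃ c : ℝ, 0 < c ∧ Tendsto (fun x : ℝ => ((idealsLE K ⌊x⌋₊).card : ℝ) / x) atTop (𝓝 c) := by
  refine ⟨_, ?_, (NumberField.Ideal.tendsto_norm_le_div_atTop₀ K).congr' ?_⟩
  · have h1 := Units.regulator_pos K
    have h2 : 0 < classNumber K := Nat.pos_of_ne_zero (classNumber_ne_zero K)
    have h3 : 0 < Units.torsionOrder K := Nat.pos_of_ne_zero (Units.torsionOrder_ne_zero K)
    have h4 : discr K ≠ 0 := discr_ne_zero K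
    have := Real.pi_pos
    positivity
  · filter_upwards [eventually_ge_atTop 0] with x hx
    congr 2
    rw [← Fintype.card_coe, ← Nat.card_eq_fintype_card]
    simp_rw [← Nat.le_floor_iff hx]
    refine Nat.card_congr
      ((Equiv.subtypeSubtypeEquivSubtypeInter (fun I : Ideal (𝓞 K) => I ∈ (Ideal (𝓞 K))⁰)
        (fun I => absNorm I ≤ ⌊x⌋₊)).trans (Equiv.subtypeEquivRight fun I => ?_))
    rw [mem_idealsLE, mem_nonZeroDivisors_iff_ne_zero, and_comm]
    rfl

theorem exists_card_idealsLE_le (K : Type*) [Field K] [NumberField K] :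
    ∃ C : ℝ, 0 < C ∧ ∀ n : ℕ, ((idealsLE K n).card : ℝ) ≤ C * n := by
  obtain ⟨c, hc, h⟩ := exists_tendsto_card_idealsLE K
  obtain ⟨B, hB, hAB⟩ := abs_sub_mul_le_of_tendsto_div (A := fun n => ((idealsLE K n).card : ℝ))
    h one_pos
  refine ⟨c + 1 + B, by positivity, fun n => ?_⟩
  rcases Nat.eq_zero_or_pos n with rfl | hn
  · have : idealsLE K 0 = ∅ := by
      ext I
      simp only [mem_idealsLE, Finset.notMem_empty, iff_false, not_and, not_not]
      exact fun hI => absNorm_eq_zero_iff.mp (Nat.le_zero.mp hI)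
    simp [this]
  · have h1 := (abs_le.mp (hAB n (by positivity))).2
    rw [Nat.floor_natCast] at h1
    have : (1 : ℝ) ≤ n := by exact_mod_cast hn
    nlinarith

theorem card_filter_dvd_idealsLE (n : ℕ) {J : Ideal (𝓞 K)} (hJ : J ≠ ⊥) :
    ((idealsLE K n).filter (J ∣ ·)).card = (idealsLE K (n / absNorm J)).card := by
  have hN := absNorm_pos hJ
  symm
  refine Finset.card_bij (fun I _ => J * I) ?_ ?_ ?_
  · intro I hI
    rw [mem_idealsLE] at hI
    rw [Finset.mem_filter, mem_idealsLE, map_mul]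
    refine ⟨⟨?_, mul_ne_zero hJ hI.2⟩, dvd_mul_right _ _⟩
    rw [mul_comm]
    exact (Nat.le_div_iff_mul_le hN).mp hI.1
  · intro I _ I' _ h
    exact mul_left_cancel₀ hJ h
  · intro I hI
    rw [Finset.mem_filter, mem_idealsLE] at hI
    obtain ⟨⟨h1, h2⟩, I', rfl⟩ := hI
    refine ⟨I', mem_idealsLE.mpr ⟨?_, right_ne_zero_of_mul h2⟩, rfl⟩
    rw [map_mul, mul_comm] at h1
    exact (Nat.le_div_iff_mul_le hN).mpr h1

/-- The ideal analogue of writing log n as a sum of the von Mangoldt function over divisors: the sum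
over k counts the multiplicity of P in I. -/
theorem log_absNorm_eq_sum {N : ℕ} {I : Ideal (𝓞 K)} (hI : I ∈ idealsLE K N) :
    Real.log (absNorm I) = ∑ P ∈ primeIdealsLE K N,
      ∑ k ∈ Finset.Icc 1 N, if P ^ k ∣ I then Real.log (absNorm P) else 0 := by
  rw [mem_idealsLE] at hI
  have h1 : ∀ P ∈ primeIdealsLE K N,
      (∑ k ∈ Finset.Icc 1 N, if P ^ k ∣ I then Real.log (absNorm P) else 0) =
      ((normalizedFactors I).count P : ℝ) * Real.log (absNorm P) := by
    intro P hP
    rw [mem_primeIdealsLE] at hP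
    have hPp : Prime P := prime_of_isPrime hP.2.1 hP.2.2
    have hdvd : ∀ k, P ^ k ∣ I ↔ k ≤ (normalizedFactors I).count P := by
      intro k
      rw [pow_dvd_iff_le_emultiplicity,
        emultiplicity_eq_count_normalizedFactors hPp.irreducible hI.2, normalize_eq]
      exact Nat.cast_le
    -- Truncating at k ≤ N loses nothing: a multiplicity e satisfies e < N(P)^e ≤ N(I) ≤ N, as N(P)
    -- ≥ 2.
    have hle : (normalizedFactors I).count P ≤ N := by
      have h2 := absNorm_dvd_absNorm_of_le (Ideal.le_of_dvd ((hdvd _).mpr le_rfl))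
      have h3 := Nat.le_of_dvd (absNorm_pos hI.2) h2
      rw [map_pow] at h3
      exact (Nat.lt_pow_self (two_le_absNorm hP.2.1 hP.2.2)).le.trans (h3.trans hI.1)
    rw [← Finset.sum_filter, Finset.sum_const, nsmul_eq_mul]
    congr 2
    have : (Finset.Icc 1 N).filter (fun k => P ^ k ∣ I) =
        Finset.Icc 1 ((normalizedFactors I).count P) := by
      ext k
      simp only [Finset.mem_filter, Finset.mem_Icc, hdvd]
      omega
    rw [this, Nat.card_Icc, Nat.add_sub_cancel]
  rw [Finset.sum_congr rfl h1]
  have hsub : ∀ P ∈ normalizedFactors I, P ∈ primeIdealsLE K N := by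
    intro P hP
    have hp := prime_of_normalized_factor P hP
    refine mem_primeIdealsLE.mpr ⟨?_, hp.ne_zero, isPrime_of_prime hp⟩
    exact (Nat.le_of_dvd (absNorm_pos hI.2) (absNorm_dvd_absNorm_of_le
      (Ideal.le_of_dvd (dvd_of_mem_normalizedFactors hP)))).trans hI.1
  have h0 : ∀ s : Multiset (Ideal (𝓞 K)), (∀ P ∈ s, P ≠ ⊥) →
      Real.log (absNorm s.prod) = (s.map fun P => Real.log (absNorm P)).sum := by
    intro s
    induction s using Multiset.induction_on with
    | empty => simp
    | cons P s ih =>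
      intro h
      have h2 : ∀ Q ∈ s, Q ≠ ⊥ := fun Q hQ => h Q (Multiset.mem_cons_of_mem hQ)
      rw [Multiset.prod_cons, map_mul, Nat.cast_mul, Real.log_mul, ih h2, Multiset.map_cons,
        Multiset.sum_cons]
      · exact_mod_cast (absNorm_pos (h P (Multiset.mem_cons_self P s))).ne'
      · refine Nat.cast_ne_zero.mpr (absNorm_pos (I := s.prod) ?_).ne'
        exact Multiset.prod_ne_zero fun h3 => h2 0 h3 rfl
  conv_lhs => rw [← Ideal.prod_normalizedFactors_eq_self hI.2]
  rw [h0 _ fun P hP => (prime_of_normalized_factor P hP).ne_zero, Finset.sum_multiset_map_count]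
  simp only [nsmul_eq_mul]
  refine Finset.sum_subset (fun P hP => hsub P (Multiset.mem_toFinset.mp hP)) fun P _ hP => ?_
  rw [Multiset.count_eq_zero_of_notMem (fun h => hP (Multiset.mem_toFinset.mpr h))]
  simp

/-- The analogue of Legendre's formula for N!: after exchanging sums, the multiples of P^k are
counted by dividing them by P^k. -/
theorem sum_log_absNorm_eq (N : ℕ) :
    ∑ I ∈ idealsLE K N, Real.log (absNorm I) = ∑ P ∈ primeIdealsLE K N,
      Real.log (absNorm P) * ∑ k ∈ Finset.Icc 1 N, ((idealsLE K (N / absNorm P ^ k)).card : ℝ) := by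
  rw [Finset.sum_congr rfl fun I hI => log_absNorm_eq_sum hI, Finset.sum_comm]
  refine Finset.sum_congr rfl fun P hP => ?_
  rw [Finset.sum_comm, Finset.mul_sum]
  refine Finset.sum_congr rfl fun k _ => ?_
  rw [← map_pow, ← card_filter_dvd_idealsLE N (pow_ne_zero k (mem_primeIdealsLE.mp hP).2.1),
    ← Finset.sum_filter, Finset.sum_const, nsmul_eq_mul, mul_comm]

/-- The product of these distinct primes divides (p), which has norm p^[K : ℚ], and each factor has
norm divisible by p. -/
theorem card_le_finrank_of_forall_natCast_mem {p : ℕ} (hp : p.Prime) (s : Finset (Ideal (𝓞 K)))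
    (hs : ∀ P ∈ s, P.IsPrime ∧ (p : 𝓞 K) ∈ P) : s.card ≤ Module.finrank ℚ K := by
  have hp0 : span {(p : 𝓞 K)} ≠ ⊥ := by
    rw [Ne, span_singleton_eq_bot]; exact_mod_cast hp.ne_zero
  have hdvd : ∏ P ∈ s, P ∣ span {(p : 𝓞 K)} := by
    refine Finset.prod_primes_dvd _ (fun P hP => ?_) fun P hP => ?_
    · refine prime_of_isPrime (fun h => ?_) (hs P hP).1
      have := (hs P hP).2
      rw [h, Ideal.mem_bot] at this
      exact hp.ne_zero (by exact_mod_cast this)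
    · rw [dvd_span_singleton]; exact (hs P hP).2
  have h1 : absNorm (∏ P ∈ s, P) ∣ p ^ Module.finrank ℤ (𝓞 K) := by
    rw [← absNorm_span_natCast]
    exact absNorm_dvd_absNorm_of_le (Ideal.le_of_dvd hdvd)
  rw [map_prod, RingOfIntegers.rank] at h1
  have h2 : p ^ s.card ∣ ∏ P ∈ s, absNorm P := by
    rw [← Finset.prod_const]
    refine Finset.prod_dvd_prod_of_dvd _ _ fun P hP => ?_
    have hPp := (hs P hP).1
    have h3 : absNorm P ∣ p ^ Module.finrank ℤ (𝓞 K) := by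
      rw [← absNorm_span_natCast]
      exact absNorm_dvd_absNorm_of_le ((span_singleton_le_iff_mem _).mpr (hs P hP).2)
    obtain ⟨k, -, hk⟩ := (Nat.dvd_prime_pow hp).mp h3
    rw [hk]
    refine dvd_pow_self p ?_
    rintro rfl
    exact hPp.ne_top (absNorm_eq_one_iff.mp (by simpa using hk))
  exact (Nat.pow_dvd_pow_iff_le_right hp.one_lt).mp (h2.trans h1)

/-- The norm of P is a power of the rational prime below P, so `minFac` of the norm names that
prime. This allows sums over prime ideals to be compared with sums over rational primes. -/
theorem natCast_minFac_mem {P : Ideal (𝓞 K)} (h0 : P ≠ ⊥) (hP : P.IsPrime) :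
    ((absNorm P).minFac : 𝓞 K) ∈ P := by
  have := hP.isMaximal h0
  obtain ⟨p, n, hn, hmem, hp, hpn⟩ := exists_prime_and_absNorm_eq_pow P
  rwa [hpn, hp.pow_minFac hn.ne']

theorem sum_primeIdealsLE_minFac_le (h : ℕ → ℝ) (hh : ∀ n, 0 ≤ h n) (N : ℕ) :
    ∑ P ∈ primeIdealsLE K N, h (absNorm P).minFac ≤
      Module.finrank ℚ K * ∑ p ∈ Finset.Icc 1 N, h p := by
  have hmaps : ∀ P ∈ primeIdealsLE K N, (absNorm P).minFac ∈ Finset.Icc 1 N := by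
    intro P hP
    rw [mem_primeIdealsLE] at hP
    exact Finset.mem_Icc.mpr ⟨Nat.minFac_pos _, (Nat.minFac_le (absNorm_pos hP.2.1)).trans hP.1⟩
  rw [← Finset.sum_fiberwise_of_maps_to hmaps, Finset.mul_sum]
  refine Finset.sum_le_sum fun p _ => ?_
  rw [Finset.sum_congr rfl (g := fun _ => h p)
    (fun P hP => by rw [(Finset.mem_filter.mp hP).2]), Finset.sum_const, nsmul_eq_mul]
  refine mul_le_mul_of_nonneg_right (Nat.cast_le.mpr ?_) (hh p)
  by_cases hp : p.Prime
  · refine card_le_finrank_of_forall_natCast_mem hp _ fun P hP => ?_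
    rw [Finset.mem_filter, mem_primeIdealsLE] at hP
    refine ⟨hP.1.2.2, ?_⟩
    rw [← hP.2]
    exact natCast_minFac_mem hP.1.2.1 hP.1.2.2
  · rw [Finset.card_eq_zero.mpr]
    · exact Nat.zero_le _
    refine Finset.filter_eq_empty_iff.mpr fun P hP h => hp ?_
    rw [mem_primeIdealsLE] at hP
    rw [← h]
    exact Nat.minFac_prime (by have := two_le_absNorm hP.2.1 hP.2.2; omega)

theorem exists_sum_rpow_minFac_le (K : Type*) [Field K] [NumberField K] :
    ∃ B : ℝ, 0 ≤ B ∧ ∀ N : ℕ,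
      ∑ P ∈ primeIdealsLE K N, ((absNorm P).minFac : ℝ) ^ (-(3 / 2) : ℝ) ≤ B := by
  have hs : Summable fun n : ℕ => (n : ℝ) ^ (-(3 / 2) : ℝ) :=
    Real.summable_nat_rpow.mpr (by norm_num)
  refine ⟨Module.finrank ℚ K * ∑' n : ℕ, (n : ℝ) ^ (-(3 / 2) : ℝ),
    mul_nonneg (Nat.cast_nonneg _) (tsum_nonneg fun n => by positivity), fun N => ?_⟩
  refine (sum_primeIdealsLE_minFac_le (fun n : ℕ => (n : ℝ) ^ (-(3 / 2) : ℝ))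
    (fun n => by positivity) N).trans ?_
  gcongr
  exact hs.sum_le_tsum _ fun n _ => by positivity

/-- Controls the powers k ≥ 2 of P by a term that is summable over the rational primes below. -/
theorem log_div_sq_le {P : Ideal (𝓞 K)} (h0 : P ≠ ⊥) :
    Real.log (absNorm P) / (absNorm P : ℝ) ^ 2 ≤
      2 * ((absNorm P).minFac : ℝ) ^ (-(3 / 2) : ℝ) := by
  have hq : (0 : ℝ) < absNorm P := by exact_mod_cast absNorm_pos h0
  have hm : (0 : ℝ) < (absNorm P).minFac := by exact_mod_cast Nat.minFac_pos _
  have h1 := Real.log_le_rpow_div hq.le (ε := 1 / 2) (by norm_num)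
  calc _ ≤ ((absNorm P : ℝ) ^ (1 / 2 : ℝ) / (1 / 2)) / (absNorm P : ℝ) ^ 2 := by gcongr
    _ = 2 * (absNorm P : ℝ) ^ (-(3 / 2) : ℝ) := by
      rw [show (-(3 / 2) : ℝ) = 1 / 2 - 2 by norm_num, Real.rpow_sub hq]
      norm_num; ring
    _ ≤ _ := by
      gcongr 2 * ?_
      exact Real.rpow_le_rpow_of_nonpos hm
        (by exact_mod_cast Nat.minFac_le (absNorm_pos h0)) (by norm_num)

/-- A norm q that is not prime is at least the square of its least prime factor, so log q ≤ 4
q^(1/4) yields the same summable exponent -3/2. -/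
theorem log_div_le_of_not_prime {P : Ideal (𝓞 K)} (h0 : P ≠ ⊥) (hn : ¬ (absNorm P).Prime) :
    Real.log (absNorm P) / (absNorm P : ℝ) ≤ 4 * ((absNorm P).minFac : ℝ) ^ (-(3 / 2) : ℝ) := by
  have hq : (0 : ℝ) < absNorm P := by exact_mod_cast absNorm_pos h0
  have hm : (0 : ℝ) < (absNorm P).minFac := by exact_mod_cast Nat.minFac_pos _
  have h1 := Real.log_le_rpow_div hq.le (ε := 1 / 4) (by norm_num)
  have h2 : ((absNorm P).minFac : ℝ) ^ 2 ≤ absNorm P := by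
    exact_mod_cast Nat.minFac_sq_le_self (absNorm_pos h0) hn
  calc _ ≤ ((absNorm P : ℝ) ^ (1 / 4 : ℝ) / (1 / 4)) / (absNorm P : ℝ) := by gcongr
    _ = 4 * (absNorm P : ℝ) ^ (-(3 / 4) : ℝ) := by
      rw [show (-(3 / 4) : ℝ) = 1 / 4 - 1 by norm_num, Real.rpow_sub hq, Real.rpow_one]
      ring
    _ ≤ 4 * (((absNorm P).minFac : ℝ) ^ 2) ^ (-(3 / 4) : ℝ) := by
      gcongr 4 * ?_
      exact Real.rpow_le_rpow_of_nonpos (by positivity) h2 (by norm_num)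
    _ = _ := by
      rw [← Real.rpow_natCast, ← Real.rpow_mul hm.le]; norm_num

end NumberField

end PolyLcm

/-! ### Mertens' theorem for prime ideals and for roots modulo p -/

namespace PolyLcm

section NumberField

open NumberField Ideal
open scoped Classical

variable {K : Type*} [Field K] [NumberField K]

theorem sum_primeIdealsLE_prime_norm (F : ℕ → ℝ) (N : ℕ) :
    ∑ P ∈ (primeIdealsLE K N).filter (fun P => (absNorm P).Prime), F (absNorm P) =
      ∑ n ∈ Finset.Icc 1 N,
        if n.Prime then (Nat.card {P : Ideal (𝓞 K) // absNorm P = n} : ℝ) * F n else 0 := by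
  have hmaps : ∀ P ∈ (primeIdealsLE K N).filter (fun P => (absNorm P).Prime),
      absNorm P ∈ Finset.Icc 1 N := by
    intro P hP
    rw [Finset.mem_filter, mem_primeIdealsLE] at hP
    exact Finset.mem_Icc.mpr ⟨hP.2.one_le, hP.1.1⟩
  rw [← Finset.sum_fiberwise_of_maps_to hmaps]
  refine Finset.sum_congr rfl fun n hn => ?_
  rw [Finset.sum_congr rfl (g := fun _ => F n)
    (fun P hP => by rw [(Finset.mem_filter.mp hP).2]), Finset.sum_const, nsmul_eq_mul]
  split_ifs with hp
  · congr 2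
    rw [← Fintype.card_coe, ← Nat.card_eq_fintype_card]
    refine Nat.card_congr (Equiv.subtypeEquivRight fun P => ?_)
    rw [Finset.mem_filter, Finset.mem_filter, mem_primeIdealsLE]
    refine ⟨fun h => h.2, fun h => ⟨⟨⟨?_, ?_, ?_⟩, ?_⟩, h⟩⟩
    · rw [h]; exact (Finset.mem_Icc.mp hn).2
    · rintro rfl
      rw [absNorm_bot] at h
      exact hp.ne_zero h.symm
    · exact isPrime_of_irreducible_absNorm (by rw [h]; exact hp)
    · rwa [h]
  · rw [Finset.card_eq_zero.mpr, Nat.cast_zero, zero_mul]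
    refine Finset.filter_eq_empty_iff.mpr fun P hP h => hp ?_
    rw [← h]
    exact (Finset.mem_filter.mp hP).2

theorem natCard_absNorm_le_finrank {p : ℕ} (hp : p.Prime) :
    Nat.card {P : Ideal (𝓞 K) // absNorm P = p} ≤ Module.finrank ℚ K := by
  have hfin := finite_setOfPred_absNorm_eq (S := 𝓞 K) p
  have h : Nat.card {P : Ideal (𝓞 K) // absNorm P = p} = hfin.toFinset.card :=
    Nat.card_eq_card_finite_toFinset hfin
  rw [h]
  refine card_le_finrank_of_forall_natCast_mem hp _ fun P hP => ?_
  have hP' : absNorm P = p := by simpa using hP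
  refine ⟨isPrime_of_irreducible_absNorm (by rw [hP']; exact hp), ?_⟩
  rw [← hP']
  exact absNorm_mem P

/-- Each logarithm is at most log N. Conversely, only O(N / log N) ideals have norm at most y = N /
log N, and all the others contribute at least log N - log log N. -/
theorem tendsto_sum_log_absNorm {c : ℝ}
    (hc : Tendsto (fun x : ℝ => ((idealsLE K ⌊x⌋₊).card : ℝ) / x) atTop (𝓝 c)) :
    Tendsto (fun N : ℕ => (∑ I ∈ idealsLE K N, Real.log (absNorm I)) / (N * Real.log N))
      atTop (𝓝 c) := by
  obtain ⟨C, hC, hCA⟩ := exists_card_idealsLE_le K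
  have hcN : Tendsto (fun N : ℕ => ((idealsLE K N).card : ℝ) / N) atTop (𝓝 c) := by
    simpa [Function.comp_def] using hc.comp (tendsto_natCast_atTop_atTop (R := ℝ))
  have hlog : Tendsto (fun N : ℕ => Real.log N) atTop atTop :=
    Real.tendsto_log_atTop.comp tendsto_natCast_atTop_atTop
  have hll : Tendsto (fun N : ℕ => Real.log (Real.log N) / Real.log N) atTop (𝓝 0) :=
    Real.isLittleO_log_id_atTop.tendsto_div_nhds_zero.comp hlog
  have hlow : Tendsto (fun N : ℕ => (((idealsLE K N).card : ℝ) / N - C / Real.log N) *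
      (1 - Real.log (Real.log N) / Real.log N)) atTop (𝓝 c) := by
    have := (hcN.sub (hlog.const_div_atTop C)).mul (hll.const_sub 1)
    simpa using this
  refine tendsto_of_tendsto_of_tendsto_of_le_of_le' hlow hcN ?_ ?_
  · filter_upwards [eventually_gt_atTop 0, hlog.eventually_gt_atTop 1] with N hN hl
    have hN' : (0 : ℝ) < N := by exact_mod_cast hN
    have hl0 : 0 < Real.log N := by linarith
    set y : ℝ := N / Real.log N with hy
    have hy0 : 0 < y := by positivity
    have hly : Real.log y = Real.log N - Real.log (Real.log N) := Real.log_div hN'.ne' hl0.ne'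
    have hll0 : 0 ≤ Real.log y := by
      rw [hly]
      have := Real.log_le_self hl0.le
      linarith
    have hyN : ⌊y⌋₊ ≤ N := by
      rw [← Nat.floor_natCast (R := ℝ) N]
      exact Nat.floor_le_floor (div_le_self hN'.le hl.le)
    have hsub : idealsLE K ⌊y⌋₊ ⊆ idealsLE K N := fun I hI => by
      rw [mem_idealsLE] at hI ⊢; exact ⟨hI.1.trans hyN, hI.2⟩
    have h1 : ((idealsLE K N \ idealsLE K ⌊y⌋₊).card : ℝ) * Real.log y ≤
        ∑ I ∈ idealsLE K N, Real.log (absNorm I) := by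
      calc _ = ∑ I ∈ idealsLE K N \ idealsLE K ⌊y⌋₊, Real.log y := by
            rw [Finset.sum_const, nsmul_eq_mul]
        _ ≤ ∑ I ∈ idealsLE K N \ idealsLE K ⌊y⌋₊, Real.log (absNorm I) := by
            refine Finset.sum_le_sum fun I hI => ?_
            rw [Finset.mem_sdiff, mem_idealsLE, mem_idealsLE] at hI
            refine Real.log_le_log hy0 (Nat.lt_of_floor_lt ?_).le
            by_contra h
            exact hI.2 ⟨not_lt.mp h, hI.1.2⟩
        _ ≤ _ := Finset.sum_le_sum_of_subset_of_nonneg Finset.sdiff_subset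
            fun I _ _ => Real.log_natCast_nonneg _
    have h2 : ((idealsLE K N).card : ℝ) - C * y ≤ (idealsLE K N \ idealsLE K ⌊y⌋₊).card := by
      rw [Finset.card_sdiff_of_subset hsub, Nat.cast_sub (Finset.card_le_card hsub)]
      have := (hCA ⌊y⌋₊).trans (mul_le_mul_of_nonneg_left (Nat.floor_le hy0.le) hC.le)
      linarith
    rw [le_div_iff₀ (by positivity)]
    refine le_trans (le_of_eq ?_) ((mul_le_mul_of_nonneg_right h2 hll0).trans h1)
    rw [hly, hy]
    field_simp
  · filter_upwards [eventually_gt_atTop 0, hlog.eventually_gt_atTop 0] with N hN hl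
    have hN' : (0 : ℝ) < N := by exact_mod_cast hN
    rw [div_le_iff₀ (by positivity)]
    have : ((idealsLE K N).card : ℝ) / N * (N * Real.log N) =
        ∑ I ∈ idealsLE K N, Real.log N := by
      rw [Finset.sum_const, nsmul_eq_mul]; field_simp
    rw [this]
    refine Finset.sum_le_sum fun I hI => ?_
    rw [mem_idealsLE] at hI
    exact Real.log_le_log (by exact_mod_cast absNorm_pos hI.2) (by exact_mod_cast hI.1)

theorem sum_div_pow_sub_le {a : ℕ → ℝ} (ha : ∀ n, 0 ≤ a n) {C : ℝ} (hC : 0 ≤ C)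
    (haC : ∀ n : ℕ, a n ≤ C * n) {q N : ℕ} (hq : 2 ≤ q) (hN : 1 ≤ N) :
    0 ≤ ∑ k ∈ Finset.Icc 1 N, a (N / q ^ k) - a (N / q) ∧
      ∑ k ∈ Finset.Icc 1 N, a (N / q ^ k) - a (N / q) ≤ 2 * C * N / (q : ℝ) ^ 2 := by
  have hq2' : (2 : ℝ) ≤ q := by exact_mod_cast hq
  rw [← Finset.Ico_add_one_right_eq_Icc, Finset.sum_eq_sum_Ico_succ_bot (by omega), pow_one,
    add_sub_cancel_left]
  refine ⟨Finset.sum_nonneg fun _ _ => ha _, ?_⟩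
  calc _ ≤ ∑ k ∈ Finset.Ico 2 (N + 1), C * N * ((q : ℝ)⁻¹) ^ k := by
        refine Finset.sum_le_sum fun k _ =>
          ((haC _).trans (mul_le_mul_of_nonneg_left Nat.cast_div_le hC)).trans (le_of_eq ?_)
        rw [Nat.cast_pow, inv_pow]; ring
    _ = C * N * ∑ k ∈ Finset.Ico 2 (N + 1), ((q : ℝ)⁻¹) ^ k := by rw [Finset.mul_sum]
    _ ≤ C * N * (((q : ℝ)⁻¹) ^ 2 / (1 - (q : ℝ)⁻¹)) := by
        gcongr
        exact geom_sum_Ico_le_of_lt_one (by positivity) (inv_lt_one_of_one_lt₀ (by linarith))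
    _ ≤ C * N * (((q : ℝ)⁻¹) ^ 2 / (1 / 2)) := by
        gcongr
        have : (q : ℝ)⁻¹ ≤ 2⁻¹ := inv_anti₀ (by norm_num) hq2'
        linarith
    _ = _ := by rw [inv_pow]; ring

/-- The constant 8 is 4 for the powers k ≥ 2 plus 4 for the first power, which is an error only when
the norm is not prime. -/
theorem abs_log_mul_sum_sub_le {a : ℕ → ℝ} (ha : ∀ n, 0 ≤ a n) {C : ℝ} (hC : 0 ≤ C)
    (haC : ∀ n : ℕ, a n ≤ C * n) {N : ℕ} {P : Ideal (𝓞 K)} (hP : P ∈ primeIdealsLE K N) :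
    |Real.log (absNorm P) * ∑ k ∈ Finset.Icc 1 N, a (N / absNorm P ^ k) -
        if (absNorm P).Prime then Real.log (absNorm P) * a (N / absNorm P) else 0| ≤
      8 * C * N * ((absNorm P).minFac : ℝ) ^ (-(3 / 2) : ℝ) := by
  rw [mem_primeIdealsLE] at hP
  obtain ⟨hPN, hP0, hPp⟩ := hP
  have h1 := log_div_sq_le hP0
  have h2 := log_div_le_of_not_prime hP0
  have hq2 : 2 ≤ absNorm P := two_le_absNorm hP0 hPp
  clear hPp hP0
  generalize absNorm P = q at *
  have hm0 : (0 : ℝ) ≤ (q.minFac : ℝ) ^ (-(3 / 2) : ℝ) := by positivity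
  generalize (q.minFac : ℝ) ^ (-(3 / 2) : ℝ) = z at *
  have hlq : 0 ≤ Real.log q := Real.log_natCast_nonneg q
  obtain ⟨h3, h4⟩ := sum_div_pow_sub_le ha hC haC hq2 (show 1 ≤ N by omega)
  have hCN : 0 ≤ C * N * z := by positivity
  have h5 : Real.log q * (∑ k ∈ Finset.Icc 1 N, a (N / q ^ k) - a (N / q)) ≤ 4 * (C * N * z) := by
    calc _ ≤ Real.log q * (2 * C * N / (q : ℝ) ^ 2) := by gcongr
      _ = 2 * C * N * (Real.log q / (q : ℝ) ^ 2) := by ring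
      _ ≤ 2 * C * N * (2 * z) := by gcongr
      _ = _ := by ring
  have h6 := mul_nonneg hlq h3
  rw [mul_sub] at h5 h6
  split_ifs with hpr
  · rw [abs_of_nonneg h6]
    linarith
  · have h7 : Real.log q * a (N / q) ≤ 4 * (C * N * z) := by
      calc _ ≤ Real.log q * (C * (N / q)) := by
            gcongr
            exact (haC _).trans (mul_le_mul_of_nonneg_left Nat.cast_div_le hC)
        _ = C * N * (Real.log q / q) := by ring
        _ ≤ C * N * (4 * z) := by gcongr; exact h2 hpr
        _ = _ := by ring
    have h8 := mul_nonneg hlq (ha (N / q))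
    rw [sub_zero, abs_of_nonneg (by linarith)]
    linarith

/-- Only the prime ideals of prime norm, and only their first powers, matter for
`∑ log N(I)` up to `O(N)`. -/
theorem exists_abs_sum_log_absNorm_sub_le (K : Type*) [Field K] [NumberField K] :
    ∃ B : ℝ, ∀ N : ℕ, |∑ I ∈ idealsLE K N, Real.log (absNorm I) -
      ∑ P ∈ (primeIdealsLE K N).filter (fun P => (absNorm P).Prime),
        Real.log (absNorm P) * ((idealsLE K (N / absNorm P)).card : ℝ)| ≤ B * N := by
  obtain ⟨C, hC, hCA⟩ := exists_card_idealsLE_le K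
  obtain ⟨B, hB, hBs⟩ := exists_sum_rpow_minFac_le K
  refine ⟨8 * C * B, fun N => ?_⟩
  rw [sum_log_absNorm_eq, Finset.sum_filter, ← Finset.sum_sub_distrib]
  calc _ ≤ ∑ P ∈ primeIdealsLE K N, 8 * C * N * ((absNorm P).minFac : ℝ) ^ (-(3 / 2) : ℝ) :=
        (Finset.abs_sum_le_sum_abs _ _).trans (Finset.sum_le_sum fun P hP =>
          abs_log_mul_sum_sub_le (a := fun n => ((idealsLE K n).card : ℝ))
            (fun n => Nat.cast_nonneg _) hC.le hCA hP)
    _ = 8 * C * N * ∑ P ∈ primeIdealsLE K N, ((absNorm P).minFac : ℝ) ^ (-(3 / 2) : ℝ) := by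
        rw [Finset.mul_sum]
    _ ≤ 8 * C * N * B := by gcongr; exact hBs N
    _ = _ := by ring

theorem sum_log_prime_le (N : ℕ) :
    ∑ n ∈ Finset.Icc 1 N, (if n.Prime then Real.log n else 0) ≤ Real.log 4 * N := by
  refine le_trans (le_of_eq ?_) (Chebyshev.theta_le_log4_mul_x (Nat.cast_nonneg N))
  rw [Chebyshev.theta_eq_sum_Icc, Nat.floor_natCast, ← Finset.sum_filter]
  refine Finset.sum_subset (Finset.filter_subset_filter _ (Finset.Icc_subset_Icc_left zero_le_one))
    fun n hn hn' => absurd ?_ hn'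
  rw [Finset.mem_filter, Finset.mem_Icc] at hn ⊢
  exact ⟨⟨hn.2.one_le, hn.1.2⟩, hn.2⟩

/-- Mertens' theorem for the prime ideals of prime norm. -/
theorem tendsto_sum_natCard_absNorm_mul_log_div (K : Type*) [Field K] [NumberField K] :
    Tendsto (fun N : ℕ => (∑ n ∈ Finset.Icc 1 N, (if n.Prime then
      (Nat.card {P : Ideal (𝓞 K) // absNorm P = n} : ℝ) * Real.log n else 0) / n) / Real.log N)
      atTop (𝓝 1) := by
  obtain ⟨c, hc, hA⟩ := exists_tendsto_card_idealsLE K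
  refine tendsto_sum_div_log (A := fun n => ((idealsLE K n).card : ℝ))
    (C := Module.finrank ℚ K * Real.log 4) ?_ hc hA ?_ ?_
  · intro n
    split_ifs
    · exact mul_nonneg (Nat.cast_nonneg _) (Real.log_natCast_nonneg n)
    · exact le_rfl
  · intro N
    rw [mul_assoc]
    refine le_trans ?_ (mul_le_mul_of_nonneg_left (sum_log_prime_le N) (Nat.cast_nonneg _))
    rw [Finset.mul_sum]
    refine Finset.sum_le_sum fun n _ => ?_
    split_ifs with hn
    · exact mul_le_mul_of_nonneg_right (Nat.cast_le.mpr (natCard_absNorm_le_finrank hn))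
        (Real.log_natCast_nonneg n)
    · rw [mul_zero]
  · obtain ⟨B, hB⟩ := exists_abs_sum_log_absNorm_sub_le K
    have hlog : Tendsto (fun N : ℕ => Real.log N) atTop atTop :=
      Real.tendsto_log_atTop.comp tendsto_natCast_atTop_atTop
    have hdiff : Tendsto (fun N : ℕ => (∑ I ∈ idealsLE K N, Real.log (absNorm I) -
      ∑ P ∈ (primeIdealsLE K N).filter (fun P => (absNorm P).Prime),
        Real.log (absNorm P) * ((idealsLE K (N / absNorm P)).card : ℝ)) / (N * Real.log N))
        atTop (𝓝 0) := by
      refine squeeze_zero_norm' ?_ (hlog.const_div_atTop B)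
      filter_upwards [eventually_gt_atTop 0, hlog.eventually_gt_atTop 0] with N hN hl
      have hN' : (0 : ℝ) < N := by exact_mod_cast hN
      rw [Real.norm_eq_abs, abs_div, abs_of_pos (mul_pos hN' hl), div_le_div_iff₀ (by positivity) hl]
      calc _ ≤ B * N * Real.log N := by gcongr; exact hB N
        _ = _ := by ring
    have := (tendsto_sum_log_absNorm hA).sub hdiff
    rw [sub_zero] at this
    refine this.congr fun N => ?_
    rw [← sub_div, sub_sub_cancel,
      sum_primeIdealsLE_prime_norm fun n => Real.log n * ((idealsLE K (N / n)).card : ℝ)]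
    congr 1
    refine Finset.sum_congr rfl fun n _ => ?_
    split_ifs
    · ring
    · ring

end NumberField

open Polynomial NumberField in
/-- Mertens' theorem for the number of roots of an irreducible polynomial modulo primes. -/
theorem tendsto_sum_rootCount_mul_log_div (f : ℤ[X])
    (hirr : Irreducible (f.map (Int.castRingHom ℚ))) (hdeg : 1 ≤ f.natDegree) :
    Tendsto (fun N : ℕ => (∑ p ∈ (Finset.Icc 1 N : Finset ℕ) with p.Prime,
      (rootCount f p : ℝ) * Real.log p / p) / Real.log N) atTop (𝓝 1) := by
  have : Fact (Irreducible (f.map (Int.castRingHom ℚ))) := ⟨hirr⟩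
  set K := AdjoinRoot (f.map (Int.castRingHom ℚ)) with hK
  have hroot : aeval (AdjoinRoot.root (f.map (Int.castRingHom ℚ)) : K) f = 0 := by
    have h := AdjoinRoot.eval₂_root (f.map (Int.castRingHom ℚ))
    rw [eval₂_map] at h
    rw [aeval_def, ← h]
    congr 1
  have htop : Algebra.adjoin ℚ {(AdjoinRoot.root (f.map (Int.castRingHom ℚ)) : K)} = ⊤ := by
    convert! AdjoinRoot.adjoinRoot_eq_top (f := f.map (Int.castRingHom ℚ))
  obtain ⟨D, hD0, hD⟩ := exists_natCard_absNorm_eq_rootCount f hirr hdeg _ hroot htop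
  have hlog : Tendsto (fun N : ℕ => Real.log N) atTop atTop :=
    Real.tendsto_log_atTop.comp tendsto_natCast_atTop_atTop
  set u : ℕ → ℝ := fun n => if n.Prime then
    ((Nat.card {P : Ideal (𝓞 K) // Ideal.absNorm P = n} : ℝ) * Real.log n / n -
      (rootCount f n : ℝ) * Real.log n / n) else 0 with hu
  -- The two counts differ only at primes dividing D, all of them at most D, so the discrepancy is
  -- eventually constant.
  have hconst : ∀ᶠ N : ℕ in atTop, ∑ n ∈ Finset.Icc 1 N, u n = ∑ n ∈ Finset.Icc 1 D, u n := by
    filter_upwards [eventually_ge_atTop D] with N hN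
    symm
    refine Finset.sum_subset (Finset.Icc_subset_Icc_right hN) fun n hn hn' => ?_
    simp only [hu]
    split_ifs with hp
    · rw [hD n hp, sub_self]
      intro hdvd
      exact hn' (Finset.mem_Icc.mpr
        ⟨hp.one_le, Nat.le_of_dvd (Nat.pos_of_ne_zero hD0) hdvd⟩)
    · rfl
  have h0 : Tendsto (fun N : ℕ => (∑ n ∈ Finset.Icc 1 N, u n) / Real.log N) atTop (𝓝 0) := by
    refine (hlog.const_div_atTop (∑ n ∈ Finset.Icc 1 D, u n)).congr' ?_
    filter_upwards [hconst] with N hN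
    rw [hN]
  have h1 := (tendsto_sum_natCard_absNorm_mul_log_div K).sub h0
  rw [sub_zero] at h1
  refine h1.congr fun N => ?_
  rw [← sub_div, ← Finset.sum_sub_distrib, Finset.sum_filter]
  congr 1
  refine Finset.sum_congr rfl fun n _ => ?_
  simp only [hu]
  split_ifs
  · ring
  · ring

end PolyLcm

/-! ### Counting n with p^k ∣ f(n) -/

namespace PolyLcm

open Polynomial

theorem card_filter_modEq_bounds (N v : ℕ) {q : ℕ} (hq : 0 < q) :
    (N : ℝ) / q - 1 ≤ ((Finset.Icc 1 N).filter (· ≡ v [MOD q])).card ∧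
      (((Finset.Icc 1 N).filter (· ≡ v [MOD q])).card : ℝ) ≤ N / q + 1 := by
  have h := Nat.Ioc_filter_modEq_card 0 N hq v
  rw [← Finset.Icc_add_one_left_eq_Ioc, zero_add] at h
  have hq' : (0 : ℚ) < q := by exact_mod_cast hq
  have h1 := Int.floor_le (((N : ℚ) - v) / q)
  have h2 := Int.lt_floor_add_one (((N : ℚ) - v) / q)
  have h3 := Int.floor_le ((((0 : ℕ) : ℚ) - v) / q)
  have h4 := Int.lt_floor_add_one ((((0 : ℕ) : ℚ) - v) / q)
  have h5 : ((N : ℚ) - v) / q - (((0 : ℕ) : ℚ) - v) / q = N / q := by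
    rw [← sub_div]; simp
  have h6 : (0 : ℚ) ≤ (N : ℚ) / q := by positivity
  have h7 : ((((Finset.Icc 1 N).filter (· ≡ v [MOD q])).card : ℤ) : ℚ) =
      max ((⌊((N : ℚ) - v) / q⌋ : ℚ) - (⌊(((0 : ℕ) : ℚ) - v) / q⌋ : ℚ)) 0 := by
    rw [h]; push_cast; rfl
  rw [Int.cast_natCast] at h7
  constructor
  · have : (N : ℚ) / q - 1 ≤ ((Finset.Icc 1 N).filter (· ≡ v [MOD q])).card := by
      rw [h7]
      exact le_max_of_le_left (by linarith)
    have h8 := (Rat.cast_le (K := ℝ)).mpr this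
    push_cast at h8
    exact h8
  · have : (((Finset.Icc 1 N).filter (· ≡ v [MOD q])).card : ℚ) ≤ N / q + 1 := by
      rw [h7]
      exact max_le (by linarith) (by linarith)
    have h8 := (Rat.cast_le (K := ℝ)).mpr this
    push_cast at h8
    exact h8

/-- A set of integers in `[1, N]` that meets few classes modulo `m`, and at most one class
modulo `q` in each of these, is small. -/
theorem card_le_of_modEq_imp_modEq {N m q : ℕ} (hq : 0 < q) {S : Finset ℕ}
    (hS : S ⊆ Finset.Icc 1 N)
    (h : ∀ a ∈ S, ∀ b ∈ S, a ≡ b [MOD m] → a ≡ b [MOD q]) :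
    (S.card : ℝ) ≤ (S.image (· % m)).card * ((N : ℝ) / q + 1) := by
  rw [Finset.card_eq_sum_card_image (· % m) S, Nat.cast_sum, ← nsmul_eq_mul]
  refine Finset.sum_le_card_nsmul _ _ _ fun c hc => ?_
  obtain ⟨a, ha, rfl⟩ := Finset.mem_image.mp hc
  refine le_trans (Nat.cast_le.mpr (Finset.card_le_card ?_)) (card_filter_modEq_bounds N a hq).2
  intro b hb
  rw [Finset.mem_filter] at hb ⊢
  exact ⟨hS hb.1, h b hb.1 a ha hb.2⟩

/-- The number of `n ≤ N` with `q ∣ f(n)`. -/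
def divCount (f : ℤ[X]) (q N : ℕ) : ℕ :=
  ((Finset.Icc 1 N).filter (fun n : ℕ => (q : ℤ) ∣ f.eval (n : ℤ))).card

theorem dvd_eval_iff_of_modEq (f : ℤ[X]) {q a b : ℕ} (h : a ≡ b [MOD q]) :
    (q : ℤ) ∣ f.eval (a : ℤ) ↔ (q : ℤ) ∣ f.eval (b : ℤ) := by
  have h1 : (q : ℤ) ∣ f.eval (b : ℤ) - f.eval (a : ℤ) :=
    (Nat.modEq_iff_dvd.mp h).trans (sub_dvd_eval_sub _ _ f)
  exact ⟨fun h2 => by simpa using dvd_add h1 h2, fun h2 => (dvd_sub_right h2).mp h1⟩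

theorem rootCount_mul_le_divCount (f : ℤ[X]) {p : ℕ} (hp : 0 < p) (N : ℕ) :
    (rootCount f p : ℝ) * ((N : ℝ) / p - 1) ≤ divCount f p N := by
  have hmaps : ∀ n ∈ (Finset.Icc 1 N).filter (fun n : ℕ => (p : ℤ) ∣ f.eval (n : ℤ)),
      n % p ∈ (Finset.range p).filter (fun n : ℕ => (p : ℤ) ∣ f.eval (n : ℤ)) := by
    intro n hn
    rw [Finset.mem_filter] at hn ⊢
    exact ⟨Finset.mem_range.mpr (Nat.mod_lt _ hp),
      (dvd_eval_iff_of_modEq f (Nat.mod_modEq n p)).mpr hn.2⟩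
  rw [divCount, Finset.card_eq_sum_card_fiberwise hmaps, Nat.cast_sum, rootCount, ← nsmul_eq_mul]
  refine Finset.card_nsmul_le_sum _ _ _ fun r hr => ?_
  refine (card_filter_modEq_bounds N r hp).1.trans (Nat.cast_le.mpr (Finset.card_le_card ?_))
  intro n hn
  rw [Finset.mem_filter] at hn hr
  rw [Finset.mem_filter, Finset.mem_filter]
  refine ⟨⟨hn.1, (dvd_eval_iff_of_modEq f hn.2).mpr hr.2⟩, ?_⟩
  rw [← Nat.mod_eq_of_lt (Finset.mem_range.mp hr.1)]
  exact hn.2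

theorem card_image_mod_le_rootCount (f : ℤ[X]) {p : ℕ} (hp : 0 < p) {S : Finset ℕ}
    (hS : ∀ n ∈ S, (p : ℤ) ∣ f.eval (n : ℤ)) : (S.image (· % p)).card ≤ rootCount f p := by
  refine Finset.card_le_card fun r hr => ?_
  obtain ⟨n, hn, rfl⟩ := Finset.mem_image.mp hr
  exact Finset.mem_filter.mpr ⟨Finset.mem_range.mpr (Nat.mod_lt _ hp),
    (dvd_eval_iff_of_modEq f (Nat.mod_modEq n p)).mpr (hS n hn)⟩

/-- In valuations: v(b) ≤ E - 1, hence v(a) ≥ k - (E - 1). For E = 0 the hypothesis on b is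
impossible. -/
theorem pow_dvd_left_of_pow_dvd_mul {p : ℤ} (hp : Prime p) {E : ℕ} :
    ∀ {k : ℕ} {a b : ℤ}, p ^ k ∣ a * b → ¬ p ^ E ∣ b → p ^ (k + 1 - E) ∣ a := by
  induction E with
  | zero => intro k a b _ h; simp at h
  | succ E ih =>
    intro k a b h hb
    by_cases hpb : p ∣ b
    · obtain ⟨b', rfl⟩ := hpb
      have hb' : ¬ p ^ E ∣ b' := fun h' => hb (by rw [pow_succ']; exact mul_dvd_mul_left p h')
      rcases k with _ | k
      · simp
      · have h2 : p ^ k ∣ a * b' := by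
          rw [pow_succ', mul_left_comm] at h
          exact Int.dvd_of_mul_dvd_mul_left hp.ne_zero h
        have := ih h2 hb'
        rwa [Nat.add_sub_add_right]
    · have := hp.pow_dvd_of_dvd_mul_right k hpb h
      exact (pow_dvd_pow p (by omega)).trans this

/-- The uniqueness part of Hensel's lemma. -/
theorem modEq_of_pow_dvd_eval {f : ℤ[X]} {D : ℤ} {u v : ℤ[X]}
    (huv : u * f + v * derivative f = C D) {p : ℕ} (hp : p.Prime) {E k : ℕ}
    (hE : ¬ (p : ℤ) ^ E ∣ D) (hk : E ≤ k) {a b : ℕ} (ha : ((p ^ k : ℕ) : ℤ) ∣ f.eval (a : ℤ))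
    (hb : ((p ^ k : ℕ) : ℤ) ∣ f.eval (b : ℤ)) (hab : a ≡ b [MOD p ^ E]) :
    a ≡ b [MOD p ^ (k + 1 - E)] := by
  obtain ⟨t, ht⟩ := f.binomExpansion (a : ℤ) ((b : ℤ) - a)
  rw [add_sub_cancel] at ht
  push_cast at ha hb
  have hab' : (p : ℤ) ^ E ∣ (b : ℤ) - a := by exact_mod_cast Nat.modEq_iff_dvd.mp hab
  have h1 : (p : ℤ) ^ k ∣ ((b : ℤ) - a) * ((derivative f).eval (a : ℤ) + t * ((b : ℤ) - a)) := by
    have : ((b : ℤ) - a) * ((derivative f).eval (a : ℤ) + t * ((b : ℤ) - a)) =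
        f.eval (b : ℤ) - f.eval (a : ℤ) := by rw [ht]; ring
    rw [this]
    exact dvd_sub hb ha
  -- Otherwise p^E divides f'(a), since it divides b - a; it also divides f(a), hence D by the
  -- Bézout identity.
  have h2 : ¬ (p : ℤ) ^ E ∣ (derivative f).eval (a : ℤ) + t * ((b : ℤ) - a) := by
    intro h
    have h3 := (dvd_add_left (hab'.mul_left t)).mp h
    have h4 := congrArg (eval (a : ℤ)) huv
    rw [eval_add, eval_mul, eval_mul, eval_C] at h4
    refine hE ?_
    rw [← h4]
    exact dvd_add (((pow_dvd_pow _ hk).trans ha).mul_left _) (h3.mul_left _)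
  have h5 := pow_dvd_left_of_pow_dvd_mul (Nat.prime_iff_prime_int.mp hp) h1 h2
  exact Nat.modEq_iff_dvd.mpr (by exact_mod_cast h5)

/-- Meant for p dividing D: all p^E classes modulo p^E are allowed, and Hensel uniqueness leaves at
most one class modulo p^(k+1-E) above each. -/
theorem divCount_le {f : ℤ[X]} {D : ℤ} {u v : ℤ[X]}
    (huv : u * f + v * derivative f = C D) {p : ℕ} (hp : p.Prime) {E k : ℕ}
    (hE : ¬ (p : ℤ) ^ E ∣ D) (hk : E ≤ k) (N : ℕ) :
    (divCount f (p ^ k) N : ℝ) ≤ p ^ E * ((N : ℝ) / p ^ (k + 1 - E) + 1) := by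
  have hq : 0 < p ^ (k + 1 - E) := Nat.pow_pos hp.pos
  have h := card_le_of_modEq_imp_modEq (N := N) (m := p ^ E) hq
    (Finset.filter_subset (fun n : ℕ => ((p ^ k : ℕ) : ℤ) ∣ f.eval (n : ℤ)) (Finset.Icc 1 N))
    fun a ha b hb hab => modEq_of_pow_dvd_eval huv hp hE hk (Finset.mem_filter.mp ha).2
      (Finset.mem_filter.mp hb).2 hab
  rw [Nat.cast_pow (α := ℝ)] at h
  have h0 : (0 : ℝ) ≤ (N : ℝ) / p ^ (k + 1 - E) + 1 := by positivity
  refine h.trans (mul_le_mul_of_nonneg_right ?_ h0)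
  rw [← Nat.cast_pow, Nat.cast_le]
  refine (Finset.card_le_card (t := Finset.range (p ^ E)) fun r hr => ?_).trans
    (Finset.card_range _).le
  obtain ⟨n, -, rfl⟩ := Finset.mem_image.mp hr
  exact Finset.mem_range.mpr (Nat.mod_lt _ (pow_pos hp.pos E))

/-- The case E = 1: every root modulo p lifts to at most one class modulo p^k. -/
theorem divCount_le_rootCount_mul {f : ℤ[X]} {D : ℤ} {u v : ℤ[X]}
    (huv : u * f + v * derivative f = C D) {p : ℕ} (hp : p.Prime)
    (hD : ¬ (p : ℤ) ∣ D) {k : ℕ} (hk : 1 ≤ k) (N : ℕ) :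
    (divCount f (p ^ k) N : ℝ) ≤ rootCount f p * ((N : ℝ) / p ^ k + 1) := by
  have hq : 0 < p ^ (k + 1 - 1) := Nat.pow_pos hp.pos
  have h := card_le_of_modEq_imp_modEq (N := N) (m := p ^ 1) hq
    (Finset.filter_subset (fun n : ℕ => ((p ^ k : ℕ) : ℤ) ∣ f.eval (n : ℤ)) (Finset.Icc 1 N))
    fun a ha b hb hab => modEq_of_pow_dvd_eval huv hp (by rwa [pow_one]) hk
      (Finset.mem_filter.mp ha).2 (Finset.mem_filter.mp hb).2 hab
  rw [Nat.add_sub_cancel, pow_one, Nat.cast_pow (α := ℝ)] at h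
  have h0 : (0 : ℝ) ≤ (N : ℝ) / p ^ k + 1 := by positivity
  refine h.trans (mul_le_mul_of_nonneg_right (Nat.cast_le.mpr ?_) h0)
  refine card_image_mod_le_rootCount f hp.pos fun n hn => ?_
  refine (?_ : (p : ℤ) ∣ ((p ^ k : ℕ) : ℤ)).trans (Finset.mem_filter.mp hn).2
  exact_mod_cast dvd_pow_self p (by omega)

/-- The reduction of f modulo p is nonzero, since otherwise the Bézout identity would give p ∣ D. -/
theorem rootCount_le_natDegree {f : ℤ[X]} {D : ℤ} {u v : ℤ[X]}
    (huv : u * f + v * derivative f = C D) {p : ℕ} (hp : p.Prime)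
    (hD : ¬ (p : ℤ) ∣ D) : rootCount f p ≤ f.natDegree := by
  have : Fact p.Prime := ⟨hp⟩
  set g := f.map (Int.castRingHom (ZMod p)) with hg
  have hg0 : g ≠ 0 := by
    intro h0
    have h1 := congrArg (Polynomial.map (Int.castRingHom (ZMod p))) huv
    rw [Polynomial.map_add, Polynomial.map_mul, Polynomial.map_mul, ← derivative_map, ← hg, h0,
      derivative_zero, mul_zero, mul_zero, add_zero, map_C] at h1
    have h2 : (D : ZMod p) = 0 := by simpa using (C_eq_zero.mp h1.symm)
    exact hD ((ZMod.intCast_zmod_eq_zero_iff_dvd D p).mp h2)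
  have h1 : rootCount f p ≤ g.roots.toFinset.card := by
    refine Finset.card_le_card_of_injOn (fun n : ℕ => (n : ZMod p)) ?_ ?_
    · intro n hn
      rw [Finset.mem_coe, Finset.mem_filter] at hn
      rw [Finset.mem_coe, Multiset.mem_toFinset, mem_roots hg0, IsRoot, hg, eval_map,
        eval₂_natCast_zmod]
      exact (ZMod.intCast_zmod_eq_zero_iff_dvd _ p).mpr hn.2
    · intro a ha b hb hab
      rw [Finset.mem_coe, Finset.mem_filter, Finset.mem_range] at ha hb
      have hab' := (ZMod.natCast_eq_natCast_iff' a b p).mp hab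
      rwa [Nat.mod_eq_of_lt ha.1, Nat.mod_eq_of_lt hb.1] at hab'
  exact h1.trans ((Multiset.toFinset_card_le _).trans ((card_roots' g).trans natDegree_map_le))

/-- An irreducible polynomial over ℚ is separable; clearing denominators gives D, which plays the
role of the discriminant. -/
theorem exists_bezout_derivative {f : ℤ[X]} (hirr : Irreducible (f.map (Int.castRingHom ℚ))) :
    ∃ (D : ℤ) (u v : ℤ[X]), D ≠ 0 ∧ u * f + v * derivative f = C D := by
  obtain ⟨a, b, hab⟩ := hirr.separable
  obtain ⟨s, hs, hs'⟩ := IsLocalization.integerNormalization_spec (nonZeroDivisors ℤ) a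
  obtain ⟨t, ht, ht'⟩ := IsLocalization.integerNormalization_spec (nonZeroDivisors ℤ) b
  set a' := IsLocalization.integerNormalization (nonZeroDivisors ℤ) a
  set b' := IsLocalization.integerNormalization (nonZeroDivisors ℤ) b
  refine ⟨s * t, C t * a', C s * b',
    mul_ne_zero (nonZeroDivisors.ne_zero hs) (nonZeroDivisors.ne_zero ht), ?_⟩
  apply Polynomial.map_injective (Int.castRingHom ℚ) Int.cast_injective
  have h1 : a'.map (Int.castRingHom ℚ) = C (s : ℚ) * a := by
    rw [← smul_eq_C_mul, Int.cast_smul_eq_zsmul]; exact hs'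
  have h2 : b'.map (Int.castRingHom ℚ) = C (t : ℚ) * b := by
    rw [← smul_eq_C_mul, Int.cast_smul_eq_zsmul]; exact ht'
  rw [derivative_map] at hab
  simp only [Polynomial.map_add, Polynomial.map_mul, Polynomial.map_C, h1, h2, map_mul]
  simp only [eq_intCast (Int.castRingHom ℚ)]
  linear_combination (C (s : ℚ) * C (t : ℚ)) * hab

theorem eval_ne_zero_of_irreducible {f : ℤ[X]}
    (hirr : Irreducible (f.map (Int.castRingHom ℚ))) (hdeg : 2 ≤ f.natDegree) (n : ℤ) :
    f.eval n ≠ 0 := by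
  intro h
  have h1 : (f.map (Int.castRingHom ℚ)).IsRoot (n : ℚ) := by
    rw [IsRoot, eval_intCast_map]; simp [h]
  have h2 : (f.map (Int.castRingHom ℚ)).natDegree = 1 :=
    natDegree_eq_of_degree_eq_some (degree_eq_one_of_irreducible_of_root hirr h1)
  rw [natDegree_map_eq_of_injective Int.cast_injective] at h2
  omega

theorem exists_natAbs_eval_le (f : ℤ[X]) :
    ∃ C : ℕ, 0 < C ∧ ∀ N n : ℕ, n ∈ Finset.Icc 1 N →
      (f.eval (n : ℤ)).natAbs ≤ C * N ^ f.natDegree := by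
  refine ⟨∑ i ∈ Finset.range (f.natDegree + 1), (f.coeff i).natAbs + 1, Nat.succ_pos _,
    fun N n hn => ?_⟩
  rw [Finset.mem_Icc] at hn
  rw [eval_eq_sum_range]
  refine (Int.natAbs_sum_le _ _).trans ?_
  rw [add_mul, Finset.sum_mul]
  refine le_add_right (Finset.sum_le_sum fun i hi => ?_)
  rw [Int.natAbs_mul, Int.natAbs_pow, Int.natAbs_natCast]
  refine Nat.mul_le_mul_left _ ((Nat.pow_le_pow_left hn.2 i).trans ?_)
  exact Nat.pow_le_pow_right (by omega) (by rw [Finset.mem_range] at hi; omega)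

theorem factorization_eq_sum_ite {p m H : ℕ} (hp : p.Prime) (hm : m ≠ 0)
    (hH : m.factorization p ≤ H) :
    m.factorization p = ∑ k ∈ Finset.Icc 1 H, if p ^ k ∣ m then 1 else 0 := by
  rw [← Finset.sum_filter, Finset.sum_const, smul_eq_mul, mul_one]
  have : (Finset.Icc 1 H).filter (fun k => p ^ k ∣ m) = Finset.Icc 1 (m.factorization p) := by
    ext k
    simp only [Finset.mem_filter, Finset.mem_Icc, hp.pow_dvd_iff_le_factorization hm]
    omega
  rw [this, Nat.card_Icc, Nat.add_sub_cancel]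

theorem alpha_eq_sum_divCount {f : ℤ[X]} (hf : ∀ n : ℤ, f.eval n ≠ 0) {p N H : ℕ} (hp : p.Prime)
    (hH : ∀ n ∈ Finset.Icc 1 N, (f.eval (n : ℤ)).natAbs.factorization p ≤ H) :
    alpha f p N = ∑ k ∈ Finset.Icc 1 H, divCount f (p ^ k) N := by
  have hf' : ∀ n : ℤ, (f.eval n).natAbs ≠ 0 := fun n => Int.natAbs_ne_zero.mpr (hf n)
  rw [alpha, Q, Nat.factorization_prod (g := fun n : ℕ => (f.eval (n : ℤ)).natAbs)
      fun n _ => hf' n, Finset.sum_apply',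
    Finset.sum_congr rfl fun (n : ℕ) hn => factorization_eq_sum_ite hp (hf' n) (hH n hn),
    Finset.sum_comm]
  refine Finset.sum_congr rfl fun k _ => ?_
  rw [divCount, Finset.card_filter]
  simp only [Int.natCast_dvd]

end PolyLcm

/-! ### Asymptotics of log Q_S and the bound for log L -/

namespace PolyLcm

open Polynomial

theorem tendsto_log_natCast : Tendsto (fun N : ℕ => Real.log N) atTop atTop :=
  Real.tendsto_log_atTop.comp tendsto_natCast_atTop_atTop

theorem tendsto_card_primes_div :
    Tendsto (fun N : ℕ => (((Finset.Icc 1 N).filter Nat.Prime).card : ℝ) / N) atTop (𝓝 0) := by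
  have h := tendsto_natCast_atTop_atTop.eventually
    (Chebyshev.eventually_primeCounting_le (ε := 1) one_pos)
  refine squeeze_zero' (Eventually.of_forall fun N => by positivity) ?_
    (tendsto_log_natCast.const_div_atTop (Real.log 4 + 1))
  filter_upwards [h, eventually_gt_atTop 0] with N hN hN0
  have hN0' : (0 : ℝ) < N := by exact_mod_cast hN0
  rw [Nat.floor_natCast] at hN
  have h1 : ((Finset.Icc 1 N).filter Nat.Prime).card ≤ Nat.primeCounting N := by
    rw [Nat.primeCounting, Nat.primeCounting', Nat.count_eq_card_filter_range]
    refine Finset.card_le_card (Finset.filter_subset_filter _ fun n hn => ?_)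
    rw [Finset.mem_Icc] at hn
    exact Finset.mem_range.mpr (by omega)
  rw [div_le_iff₀ hN0']
  refine (Nat.cast_le.mpr h1).trans (hN.trans (le_of_eq ?_))
  ring

theorem tendsto_log_mul_pow_div_log {C : ℕ} (hC : 0 < C) (d : ℕ) :
    Tendsto (fun N : ℕ => Real.log ((C * N ^ d : ℕ) : ℝ) / Real.log N) atTop (𝓝 d) := by
  have h := (tendsto_log_natCast.const_div_atTop (Real.log C)).add_const (d : ℝ)
  rw [zero_add] at h
  refine h.congr' ?_
  filter_upwards [eventually_gt_atTop 0, tendsto_log_natCast.eventually_gt_atTop 0] with N hN hl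
  have hN' : (N : ℝ) ≠ 0 := by exact_mod_cast hN.ne'
  have hC' : (C : ℝ) ≠ 0 := by exact_mod_cast hC.ne'
  rw [Nat.cast_mul, Nat.cast_pow, Real.log_mul hC' (pow_ne_zero d hN'), Real.log_pow]
  field_simp

theorem natLog_mul_log_le (p : ℕ) {m : ℕ} (hm : 0 < m) :
    (Nat.log p m : ℝ) * Real.log p ≤ Real.log m := by
  rcases Nat.eq_zero_or_pos p with rfl | hp
  · simpa using Real.log_natCast_nonneg m
  rw [← Real.log_pow]
  refine Real.log_le_log (by positivity) ?_
  exact_mod_cast Nat.pow_log_le_self p hm.ne'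

theorem factorization_le_natLog {p m M : ℕ} (hp : p.Prime) (hm : m ≠ 0) (h : m ≤ M) :
    m.factorization p ≤ Nat.log p M :=
  Nat.le_log_of_pow_le hp.one_lt ((Nat.ordProj_le p hm).trans h)

theorem sum_inv_pow_le {p : ℕ} (hp : 2 ≤ p) (H : ℕ) :
    ∑ k ∈ Finset.Icc 1 H, ((p : ℝ)⁻¹) ^ k ≤ (p : ℝ)⁻¹ + 2 * ((p : ℝ)⁻¹) ^ 2 ∧
      ∑ k ∈ Finset.Icc 1 H, ((p : ℝ)⁻¹) ^ k ≤ 1 := by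
  have hp' : (2 : ℝ) ≤ p := by exact_mod_cast hp
  have hx : (p : ℝ)⁻¹ ≤ 2⁻¹ := inv_anti₀ (by norm_num) hp'
  have hx0 : 0 < (p : ℝ)⁻¹ := by positivity
  have h : ∑ k ∈ Finset.Icc 1 H, ((p : ℝ)⁻¹) ^ k ≤ ((p : ℝ)⁻¹) ^ 1 / (1 - (p : ℝ)⁻¹) := by
    rw [← Finset.Ico_add_one_right_eq_Icc]
    exact geom_sum_Ico_le_of_lt_one hx0.le (by linarith)
  rw [pow_one] at h
  generalize (p : ℝ)⁻¹ = x at *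
  constructor
  · refine h.trans ?_
    rw [div_le_iff₀ (by linarith)]
    nlinarith [mul_pos hx0 hx0]
  · refine h.trans ?_
    rw [div_le_iff₀ (by linarith)]
    linarith

theorem rootCount_mul_le_alpha {f : ℤ[X]} (hf : ∀ n : ℤ, f.eval n ≠ 0) {p : ℕ} (hp : p.Prime)
    (N : ℕ) : (rootCount f p : ℝ) * ((N : ℝ) / p - 1) ≤ alpha f p N := by
  obtain ⟨C, -, hCb⟩ := exists_natAbs_eval_le f
  -- Only the term k = 1 is kept below; the `+ 1` in H guarantees that it occurs even if the
  -- logarithm is 0.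
  rw [alpha_eq_sum_divCount hf (H := Nat.log p (C * N ^ f.natDegree) + 1) hp fun n hn =>
    (factorization_le_natLog hp (Int.natAbs_ne_zero.mpr (hf n)) (hCb N n hn)).trans
      (Nat.le_succ _)]
  refine (rootCount_mul_le_divCount f hp.pos N).trans (Nat.cast_le.mpr ?_)
  have h1 : 1 ∈ Finset.Icc 1 (Nat.log p (C * N ^ f.natDegree) + 1) := by simp
  simpa using Finset.single_le_sum (f := fun k => divCount f (p ^ k) N)
    (fun k _ => Nat.zero_le _) h1

/-- The number of relevant k is at most log M / log p, so the units in the hypothesis cost c log M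
in total. The first bound serves good primes with c = ρ(p); the second, cruder one serves primes
dividing D. -/
theorem alpha_mul_log_le {f : ℤ[X]} (hf : ∀ n : ℤ, f.eval n ≠ 0) {p N M : ℕ} (hp : p.Prime)
    (hM : 0 < M) (hb : ∀ n ∈ Finset.Icc 1 N, (f.eval (n : ℤ)).natAbs ≤ M) {c : ℝ} (hc : 0 ≤ c)
    (h : ∀ k, 1 ≤ k → (divCount f (p ^ k) N : ℝ) ≤ c * ((N : ℝ) / p ^ k + 1)) :
    (alpha f p N : ℝ) * Real.log p ≤ c * (N * Real.log p * ((p : ℝ)⁻¹ + 2 * ((p : ℝ)⁻¹) ^ 2)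
        + Real.log M) ∧
      (alpha f p N : ℝ) * Real.log p ≤ c * (N * Real.log p + Real.log M) := by
  have hl : 0 ≤ Real.log p := Real.log_natCast_nonneg p
  have h1 : (alpha f p N : ℝ) ≤ c * (N * ∑ k ∈ Finset.Icc 1 (Nat.log p M), ((p : ℝ)⁻¹) ^ k +
      Nat.log p M) := by
    rw [alpha_eq_sum_divCount hf hp fun n hn =>
      factorization_le_natLog hp (Int.natAbs_ne_zero.mpr (hf n)) (hb n hn), Nat.cast_sum]
    refine (Finset.sum_le_sum fun k hk => h k (Finset.mem_Icc.mp hk).1).trans (le_of_eq ?_)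
    rw [← Finset.mul_sum, Finset.sum_add_distrib, Finset.mul_sum]
    simp [div_eq_mul_inv]
  obtain ⟨h2, h3⟩ := sum_inv_pow_le hp.two_le (Nat.log p M)
  have h4 := natLog_mul_log_le p hM
  constructor
  · calc _ ≤ c * (N * ∑ k ∈ Finset.Icc 1 (Nat.log p M), ((p : ℝ)⁻¹) ^ k + Nat.log p M) *
          Real.log p := by gcongr
      _ = c * (N * Real.log p * ∑ k ∈ Finset.Icc 1 (Nat.log p M), ((p : ℝ)⁻¹) ^ k +
          Nat.log p M * Real.log p) := by ring
      _ ≤ _ := by gcongr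
  · calc _ ≤ c * (N * ∑ k ∈ Finset.Icc 1 (Nat.log p M), ((p : ℝ)⁻¹) ^ k + Nat.log p M) *
          Real.log p := by gcongr
      _ = c * (N * Real.log p * ∑ k ∈ Finset.Icc 1 (Nat.log p M), ((p : ℝ)⁻¹) ^ k +
          Nat.log p M * Real.log p) := by ring
      _ ≤ c * (N * Real.log p * 1 + Real.log M) := by gcongr
      _ = _ := by ring

theorem exists_alpha_mul_log_le {f : ℤ[X]} (hf : ∀ n : ℤ, f.eval n ≠ 0) {D : ℤ} {u v : ℤ[X]}
    (hD : D ≠ 0) (huv : u * f + v * derivative f = C D) (p : ℕ) :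
    ∃ B : ℝ, 0 ≤ B ∧ ∀ N M : ℕ, p.Prime → 0 < M →
      (∀ n ∈ Finset.Icc 1 N, (f.eval (n : ℤ)).natAbs ≤ M) →
      (alpha f p N : ℝ) * Real.log p ≤ B * (N + Real.log M) := by
  have hl : 0 ≤ Real.log p := Real.log_natCast_nonneg p
  -- This exponent works for every prime, since p^|D| > |D|.
  set E := D.natAbs with hE
  refine ⟨((p : ℝ) ^ E) ^ 2 * (1 + Real.log p), by positivity, fun N M hp hM hb => ?_⟩
  have hpE : ¬ (p : ℤ) ^ E ∣ D := by
    intro h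
    have h1 : p ^ E ∣ D.natAbs := by
      have := Int.natAbs_dvd_natAbs.mpr h
      rwa [Int.natAbs_pow, Int.natAbs_natCast] at this
    exact absurd (Nat.le_of_dvd (Int.natAbs_pos.mpr hD) h1) (not_le.mpr (Nat.lt_pow_self hp.one_lt))
  have hp1 : (1 : ℝ) ≤ p := by exact_mod_cast hp.one_le
  have hpE1 : (1 : ℝ) ≤ (p : ℝ) ^ E := one_le_pow₀ hp1
  have hlM := Real.log_natCast_nonneg M
  refine (alpha_mul_log_le hf hp hM hb (c := ((p : ℝ) ^ E) ^ 2) (by positivity)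
    fun k hk => ?_).2.trans ?_
  · rcases le_or_gt E k with h | h
    · refine (divCount_le huv hp hpE h N).trans ?_
      have h1 : (N : ℝ) / (p : ℝ) ^ (k + 1 - E) ≤ (p : ℝ) ^ E * (N / (p : ℝ) ^ k) := by
        have h2 : (p : ℝ) ^ (k + 1) = (p : ℝ) ^ (k + 1 - E) * (p : ℝ) ^ E := by
          rw [← pow_add]; congr 1; omega
        rw [div_le_iff₀ (by positivity), mul_div_assoc', div_mul_eq_mul_div,
          le_div_iff₀ (by positivity)]
        calc (N : ℝ) * (p : ℝ) ^ k ≤ N * (p : ℝ) ^ (k + 1) := by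
              gcongr
              omega
          _ = _ := by rw [h2]; ring
      calc _ ≤ (p : ℝ) ^ E * ((p : ℝ) ^ E * (N / (p : ℝ) ^ k) + (p : ℝ) ^ E) := by gcongr
        _ = _ := by ring
    · have h1 : (divCount f (p ^ k) N : ℝ) ≤ N := by
        refine Nat.cast_le.mpr ((Finset.card_filter_le _ _).trans ?_)
        rw [Nat.card_Icc, Nat.add_sub_cancel]
      refine h1.trans ?_
      have h2 : (N : ℝ) ≤ (p : ℝ) ^ E * (N / (p : ℝ) ^ k) := by
        rw [mul_div_assoc', le_div_iff₀ (by positivity), mul_comm]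
        gcongr
      calc (N : ℝ) ≤ (p : ℝ) ^ E * (N / (p : ℝ) ^ k) := h2
        _ ≤ ((p : ℝ) ^ E) ^ 2 * (N / (p : ℝ) ^ k) := by
            gcongr; exact le_self_pow₀ hpE1 two_ne_zero
        _ ≤ _ := by gcongr; linarith
  · rw [mul_assoc]
    gcongr
    nlinarith [mul_nonneg hl hlM, (Nat.cast_nonneg N : (0 : ℝ) ≤ N)]

theorem log_QS_eq (f : ℤ[X]) (N : ℕ) : Real.log (QS f N) =
    ∑ p ∈ (Finset.Icc 1 N).filter Nat.Prime, (alpha f p N : ℝ) * Real.log p := by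
  rw [QS, Nat.cast_prod, Real.log_prod]
  · refine Finset.sum_congr rfl fun p _ => ?_
    rw [Nat.cast_pow, Real.log_pow]
  · intro p hp
    rw [Finset.mem_filter] at hp
    exact_mod_cast (pow_pos hp.2.pos _).ne'

/-- The loss is ρ(p) log p for each prime. As ρ(p) ≤ d + |D|, Chebyshev's bound for ∑ log p makes it
O(N). -/
theorem exists_le_log_QS {f : ℤ[X]} (hf : ∀ n : ℤ, f.eval n ≠ 0) {D : ℤ} {u v : ℤ[X]}
    (hD : D ≠ 0) (huv : u * f + v * derivative f = C D) :
    ∃ R : ℝ, ∀ N : ℕ, (N : ℝ) * (∑ p ∈ (Finset.Icc 1 N).filter Nat.Prime,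
      (rootCount f p : ℝ) * Real.log p / p) - R * N ≤ Real.log (QS f N) := by
  refine ⟨(f.natDegree + D.natAbs) * Real.log 4, fun N => ?_⟩
  have hR : ∀ p : ℕ, p.Prime → (rootCount f p : ℝ) ≤ f.natDegree + D.natAbs := by
    intro p hp
    rw [← Nat.cast_add, Nat.cast_le]
    by_cases h : (p : ℤ) ∣ D
    · have h1 : rootCount f p ≤ p := (Finset.card_filter_le _ _).trans (Finset.card_range p).le
      have h2 := Nat.le_of_dvd (Int.natAbs_pos.mpr hD) (Int.natCast_dvd.mp h)
      omega
    · exact (rootCount_le_natDegree huv hp h).trans (Nat.le_add_right _ _)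
  have h1 := mul_le_mul_of_nonneg_left (sum_log_prime_le N)
    (show (0 : ℝ) ≤ f.natDegree + D.natAbs by positivity)
  rw [← Finset.sum_filter, Finset.mul_sum] at h1
  rw [log_QS_eq, Finset.mul_sum, mul_assoc]
  refine (sub_le_sub_left h1 _).trans ?_
  rw [← Finset.sum_sub_distrib]
  refine Finset.sum_le_sum fun p hp => ?_
  have hp' := (Finset.mem_filter.mp hp).2
  have hl : 0 ≤ Real.log p := Real.log_natCast_nonneg p
  have h2 := mul_le_mul_of_nonneg_right (rootCount_mul_le_alpha hf hp' N) hl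
  have h3 := mul_le_mul_of_nonneg_right (hR p hp') hl
  refine le_trans ?_ h2
  have : (rootCount f p : ℝ) * ((N : ℝ) / p - 1) * Real.log p =
      N * (rootCount f p * Real.log p / p) - rootCount f p * Real.log p := by ring
  rw [this]
  linarith

theorem exists_sum_log_mul_inv_sq_le :
    ∃ Z : ℝ, ∀ s : Finset ℕ, ∑ p ∈ s, Real.log p * ((p : ℝ)⁻¹) ^ 2 ≤ Z := by
  have hs : Summable fun n : ℕ => 2 * (n : ℝ) ^ (-(3 / 2) : ℝ) :=
    (Real.summable_nat_rpow.mpr (by norm_num)).mul_left 2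
  refine ⟨∑' n : ℕ, 2 * (n : ℝ) ^ (-(3 / 2) : ℝ), fun s => ?_⟩
  refine le_trans (Finset.sum_le_sum fun p _ => ?_)
    (hs.sum_le_tsum s fun n _ => by positivity)
  rcases Nat.eq_zero_or_pos p with rfl | hp
  · simp
  have hq : (0 : ℝ) < p := by exact_mod_cast hp
  have h1 := Real.log_le_rpow_div hq.le (ε := 1 / 2) (by norm_num)
  calc _ ≤ ((p : ℝ) ^ (1 / 2 : ℝ) / (1 / 2)) * ((p : ℝ)⁻¹) ^ 2 := by gcongr
    _ = 2 * (p : ℝ) ^ (-(3 / 2) : ℝ) := by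
      rw [show (-(3 / 2) : ℝ) = 1 / 2 - 2 by norm_num, Real.rpow_sub hq]
      norm_num; ring

/-- The error terms come respectively from the p⁻² tails, from the rounding by one unit at each
prime power, and from the finitely many primes dividing D. -/
theorem exists_log_QS_le {f : ℤ[X]} (hf : ∀ n : ℤ, f.eval n ≠ 0) {D : ℤ} {u v : ℤ[X]}
    (hD : D ≠ 0) (huv : u * f + v * derivative f = C D) :
    ∃ R B : ℝ, ∀ N M : ℕ, 0 < M → (∀ n ∈ Finset.Icc 1 N, (f.eval (n : ℤ)).natAbs ≤ M) →
      Real.log (QS f N) ≤ (N : ℝ) * (∑ p ∈ (Finset.Icc 1 N).filter Nat.Prime,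
        (rootCount f p : ℝ) * Real.log p / p) + R * N +
        f.natDegree * (((Finset.Icc 1 N).filter Nat.Prime).card * Real.log M) +
        B * (N + Real.log M) := by
  obtain ⟨Z, hZ⟩ := exists_sum_log_mul_inv_sq_le
  choose B hB0 hB using exists_alpha_mul_log_le hf hD huv
  refine ⟨2 * f.natDegree * Z, ∑ p ∈ D.natAbs.divisors, B p, fun N M hM hb => ?_⟩
  have hlM := Real.log_natCast_nonneg M
  have hterm : ∀ p ∈ (Finset.Icc 1 N).filter Nat.Prime, (alpha f p N : ℝ) * Real.log p ≤
      N * ((rootCount f p : ℝ) * Real.log p / p) +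
      2 * f.natDegree * N * (Real.log p * ((p : ℝ)⁻¹) ^ 2) + f.natDegree * Real.log M +
      (if (p : ℤ) ∣ D then B p else 0) * (N + Real.log M) := by
    intro p hp
    have hp' := (Finset.mem_filter.mp hp).2
    have hl : 0 ≤ Real.log p := Real.log_natCast_nonneg p
    split_ifs with h
    · refine (hB p N M hp' hM hb).trans (le_add_of_nonneg_left (by positivity))
    · have h1 := (alpha_mul_log_le hf hp' hM hb (Nat.cast_nonneg (rootCount f p))
        fun k hk => divCount_le_rootCount_mul huv hp' h hk N).1
      have h2 : (rootCount f p : ℝ) ≤ f.natDegree :=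
        Nat.cast_le.mpr (rootCount_le_natDegree huv hp' h)
      calc _ ≤ _ := h1
        _ = N * ((rootCount f p : ℝ) * Real.log p / p) +
            2 * rootCount f p * N * (Real.log p * ((p : ℝ)⁻¹) ^ 2) +
            rootCount f p * Real.log M + 0 * (N + Real.log M) := by ring
        _ ≤ _ := by gcongr
  rw [log_QS_eq]
  refine (Finset.sum_le_sum hterm).trans ?_
  rw [Finset.sum_add_distrib, Finset.sum_add_distrib, Finset.sum_add_distrib, ← Finset.mul_sum,
    ← Finset.mul_sum, Finset.sum_const, nsmul_eq_mul]
  refine add_le_add (add_le_add (add_le_add le_rfl ?_) (le_of_eq (by ring))) ?_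
  · calc _ ≤ 2 * f.natDegree * N * Z := by gcongr; exact hZ _
      _ = _ := by ring
  · rw [← Finset.sum_mul]
    refine mul_le_mul_of_nonneg_right ?_ (show (0 : ℝ) ≤ N + Real.log M by positivity)
    rw [← Finset.sum_filter]
    refine Finset.sum_le_sum_of_subset_of_nonneg (fun p hp => ?_) fun p _ _ => hB0 p
    rw [Finset.mem_filter] at hp
    exact Nat.mem_divisors.mpr ⟨Int.natCast_dvd.mp hp.2, Int.natAbs_ne_zero.mpr hD⟩

theorem tendsto_log_QS_div {f : ℤ[X]} (hirr : Irreducible (f.map (Int.castRingHom ℚ)))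
    (hdeg : 2 ≤ f.natDegree) :
    Tendsto (fun N : ℕ => Real.log (QS f N) / ((N : ℝ) * Real.log N)) atTop (𝓝 1) := by
  have hf := eval_ne_zero_of_irreducible hirr hdeg
  obtain ⟨D, u, v, hD, huv⟩ := exists_bezout_derivative hirr
  obtain ⟨C, hC, hCb⟩ := exists_natAbs_eval_le f
  obtain ⟨R₁, hlow⟩ := exists_le_log_QS hf hD huv
  obtain ⟨R₂, B, hup⟩ := exists_log_QS_le hf hD huv
  have hM := tendsto_sum_rootCount_mul_log_div f hirr (by omega)
  have hl := tendsto_log_natCast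
  have hℓ := tendsto_log_mul_pow_div_log hC f.natDegree
  have hπ := tendsto_card_primes_div
  have h1 := hM.sub (hl.const_div_atTop R₁)
  have h2 := ((hM.add (hl.const_div_atTop R₂)).add
    ((hπ.mul hℓ).const_mul (f.natDegree : ℝ))).add
    (((hl.const_div_atTop 1).add (hℓ.mul tendsto_inv_atTop_nhds_zero_nat)).const_mul B)
  simp only [sub_zero, add_zero, zero_mul, mul_zero] at h1 h2
  refine tendsto_of_tendsto_of_tendsto_of_le_of_le' h1 h2 ?_ ?_
  · filter_upwards [eventually_gt_atTop 0, hl.eventually_gt_atTop 0] with N hN hlN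
    have hN' : (0 : ℝ) < N := by exact_mod_cast hN
    rw [le_div_iff₀ (by positivity)]
    refine le_trans (le_of_eq ?_) (hlow N)
    field_simp
  · filter_upwards [eventually_gt_atTop 0, hl.eventually_gt_atTop 0] with N hN hlN
    have hN' : (0 : ℝ) < N := by exact_mod_cast hN
    rw [div_le_iff₀ (by positivity)]
    refine (hup N (C * N ^ f.natDegree) (by positivity) (hCb N)).trans (le_of_eq ?_)
    field_simp

theorem log_L_add_log_QS_le {f : ℤ[X]} (hf : ∀ n : ℤ, f.eval n ≠ 0) {N M : ℕ} (hM : 0 < M)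
    (hb : ∀ n ∈ Finset.Icc 1 N, (f.eval (n : ℤ)).natAbs ≤ M) :
    Real.log (L f N) + Real.log (QS f N) ≤
      N * Real.log M + ((Finset.Icc 1 N).filter Nat.Prime).card * Real.log M := by
  have hf' : ∀ n : ℤ, (f.eval n).natAbs ≠ 0 := fun n => Int.natAbs_ne_zero.mpr (hf n)
  have hQ0 : Q f N ≠ 0 := Finset.prod_ne_zero_iff.mpr fun n _ => hf' n
  set P := ∏ p ∈ (Finset.Icc 1 N).filter Nat.Prime, p ^ Nat.log p M with hP
  have hP0 : P ≠ 0 := Finset.prod_ne_zero_iff.mpr fun p hp =>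
    (pow_pos (Finset.mem_filter.mp hp).2.pos _).ne'
  have hQS0 : QS f N ≠ 0 := Finset.prod_ne_zero_iff.mpr fun p hp =>
    (pow_pos (Finset.mem_filter.mp hp).2.pos _).ne'
  have hfac : ∀ e : ℕ → ℕ, ∀ p : ℕ, p.Prime →
      (∏ q ∈ (Finset.Icc 1 N).filter Nat.Prime, q ^ e q).factorization p =
        if p ≤ N then e p else 0 := by
    intro e p hp
    rw [Nat.factorization_prod fun q hq => (pow_pos (Finset.mem_filter.mp hq).2.pos _).ne',
      Finset.sum_apply']
    have h1 : ∀ q ∈ (Finset.Icc 1 N).filter Nat.Prime,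
        (q ^ e q).factorization p = if q = p then e p else 0 := by
      intro q hq
      rw [(Finset.mem_filter.mp hq).2.factorization_pow, Finsupp.single_apply]
      split_ifs with h
      · rw [h]
      · rfl
    rw [Finset.sum_congr rfl h1, Finset.sum_ite_eq']
    refine if_congr ?_ rfl rfl
    rw [Finset.mem_filter, Finset.mem_Icc]
    exact ⟨fun h => h.1.2, fun h => ⟨⟨hp.one_le, h⟩, hp⟩⟩
  -- Compare exponents of p. If p ≤ N, those of Q_S and Q agree and f(n) contributes at most that of
  -- P; if p > N, Q_S contributes nothing and f(n) already divides Q.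
  have hdvd : ∀ n ∈ Finset.Icc 1 N, QS f N * (f.eval (n : ℤ)).natAbs ∣ Q f N * P := by
    intro n hn
    rw [← Nat.factorization_prime_le_iff_dvd (mul_ne_zero hQS0 (hf' n)) (mul_ne_zero hQ0 hP0)]
    intro p hp
    rw [Nat.factorization_mul hQS0 (hf' n), Nat.factorization_mul hQ0 hP0, Finsupp.add_apply,
      Finsupp.add_apply, QS, hfac (fun p => alpha f p N) p hp, hP, hfac _ p hp]
    split_ifs with hpN
    · exact Nat.add_le_add_left (factorization_le_natLog hp (hf' n) (hb n hn)) _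
    · rw [zero_add, add_zero]
      exact (Nat.factorization_prime_le_iff_dvd (hf' n) hQ0).mpr
        (Finset.dvd_prod_of_mem (fun n : ℕ => (f.eval (n : ℤ)).natAbs) hn) p hp
  have hQSQ : QS f N ∣ Q f N * P := by
    rw [← Nat.factorization_prime_le_iff_dvd hQS0 (mul_ne_zero hQ0 hP0)]
    intro p hp
    rw [Nat.factorization_mul hQ0 hP0, Finsupp.add_apply, QS, hfac (fun p => alpha f p N) p hp]
    split_ifs
    · exact Nat.le_add_right _ _
    · exact Nat.zero_le _
  have hL : L f N ∣ Q f N * P / QS f N :=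
    Finset.lcm_dvd fun n hn => Nat.dvd_div_of_mul_dvd (hdvd n (Finset.mem_filter.mp hn).1)
  have hmul : L f N * QS f N ≤ Q f N * P := by
    refine Nat.le_of_dvd (Nat.pos_of_ne_zero (mul_ne_zero hQ0 hP0)) ?_
    exact (Nat.dvd_div_iff_mul_dvd hQSQ).mp hL |> fun h => by rwa [mul_comm]
  have hL0 : L f N ≠ 0 := by
    intro h
    rw [L, Finset.lcm_eq_zero_iff] at h
    obtain ⟨n, -, hn⟩ := h
    exact hf' n hn
  have hcast : ∀ {m : ℕ}, m ≠ 0 → (m : ℝ) ≠ 0 := Nat.cast_ne_zero.mpr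
  have hlogP : Real.log P ≤ ((Finset.Icc 1 N).filter Nat.Prime).card * Real.log M := by
    rw [hP, Nat.cast_prod, Real.log_prod fun p hp =>
      hcast (pow_pos (Finset.mem_filter.mp hp).2.pos _).ne', ← nsmul_eq_mul]
    refine Finset.sum_le_card_nsmul _ _ _ fun p _ => ?_
    rw [Nat.cast_pow, Real.log_pow]
    exact natLog_mul_log_le p hM
  have hlogQ : Real.log (Q f N) ≤ N * Real.log M := by
    rw [Q, Nat.cast_prod, Real.log_prod fun (n : ℕ) _ => hcast (hf' n)]
    refine (Finset.sum_le_card_nsmul _ _ (Real.log M) fun n hn => ?_).trans (le_of_eq ?_)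
    · exact Real.log_le_log (Nat.cast_pos.mpr (Nat.pos_of_ne_zero (hf' n)))
        (Nat.cast_le.mpr (hb n hn))
    · rw [Nat.card_Icc, Nat.add_sub_cancel, nsmul_eq_mul]
  rw [← Real.log_mul (hcast hL0) (hcast hQS0), ← Nat.cast_mul]
  refine (Real.log_le_log (Nat.cast_pos.mpr (Nat.pos_of_ne_zero (mul_ne_zero hL0 hQS0)))
    (Nat.cast_le.mpr hmul)).trans ?_
  rw [Nat.cast_mul, Real.log_mul (hcast hQ0) (hcast hP0)]
  exact add_le_add hlogQ hlogP

/-- After division by N log N the upper bound for log L tends to d - 1, which lies strictly below (1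
+ ε)(d - 1) because d ≥ 2. -/
theorem eventually_abs_log_L_le {f : ℤ[X]} (hirr : Irreducible (f.map (Int.castRingHom ℚ)))
    (hdeg : 2 ≤ f.natDegree) {ε : ℝ} (hε : 0 < ε) : ∀ᶠ N : ℕ in atTop,
      |Real.log (L f N)| ≤ (1 + ε) * (((f.natDegree : ℝ) - 1) * ((N : ℝ) * Real.log N)) := by
  have hf := eval_ne_zero_of_irreducible hirr hdeg
  obtain ⟨C, hC, hCb⟩ := exists_natAbs_eval_le f
  have hℓ := tendsto_log_mul_pow_div_log hC f.natDegree
  have h := (hℓ.add (tendsto_card_primes_div.mul hℓ)).sub (tendsto_log_QS_div hirr hdeg)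
  rw [zero_mul, add_zero] at h
  have hd : (2 : ℝ) ≤ f.natDegree := by exact_mod_cast hdeg
  have hlt : (f.natDegree : ℝ) - 1 < (1 + ε) * ((f.natDegree : ℝ) - 1) := by nlinarith
  filter_upwards [h.eventually_lt_const hlt, eventually_gt_atTop 0,
    tendsto_log_natCast.eventually_gt_atTop 0] with N h1 hN hlN
  have hN' : (0 : ℝ) < N := by exact_mod_cast hN
  have hNl : 0 < N * Real.log N := by positivity
  have h2 := log_L_add_log_QS_le hf (show 0 < C * N ^ f.natDegree by positivity) (hCb N)
  rw [abs_of_nonneg (Real.log_natCast_nonneg _)]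
  have h3 := mul_lt_mul_of_pos_right h1 hNl
  rw [mul_assoc] at h3
  refine le_trans ?_ h3.le
  refine le_trans (le_sub_iff_add_le.mpr h2) (le_of_eq ?_)
  field_simp

end PolyLcm

theorem proposition2p1 (f : Polynomial ℤ)
    (hirr : Irreducible (f.map (Int.castRingHom ℚ))) (hdeg : 2 ≤ f.natDegree) :
    Tendsto (fun N : ℕ => Real.log (PolyLcm.QS f N) / ((N : ℝ) * Real.log N)) atTop (𝓝 1) ∧
    ∀ ε : ℝ, 0 < ε → ∀ᶠ N : ℕ in atTop,
      |Real.log (PolyLcm.L f N)| ≤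
        (1 + ε) * (((f.natDegree : ℝ) - 1) * ((N : ℝ) * Real.log N)) :=
  ⟨PolyLcm.tendsto_log_QS_div hirr hdeg, fun _ hε => PolyLcm.eventually_abs_log_L_le hirr hdeg hε⟩
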